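/- Let $G$ be a profinite group. For a finite field $F$ and $n\ge 1$ let $r^\ast(G,F,n)$ be the number of isomorphism classes of continuous $n$-dimensional representations of $G$ over $F$ that are absolutely irreducible, i.e. irreducible over $F$ and still irreducible after base change to the algebraic closure $\overline{F}$. Suppose that $G$ has UBERG: there is a constant $c>0$ such that $r^\ast(G,F,n)\le |F|^{cn}$ for all finite fields $F$ and all $n\geq 1$. Let $R=\widehat{\mathbb{Z}}\llbracket G\rrbracket=\varprojlim_{N,m}(\mathbb{Z}/m)[G/N]$ be the completed group ring of $G$, the inverse limit being over all open normal subgroups $N$ of $G$ and all $m\ge 1$, with its profinite topology. For an integer $\ell\ge 0$ let $P_R(R,\ell)$ be the normalised Haar measure of the set of tuples in $R^\ell$ that generate $R$ as a left $R$-module. Then for all sufficiently large integers $\ell$ the series in $$\zeta_G(\ell)=\exp\left(\sum_{p\ \mathrm{prime}}\ \sum_{n=1}^\infty\sum_{j=1}^\infty \frac{r^\ast(G,\mathbb{F}_{p^j},n)}{j}\,p^{-\ell nj}\,|\mathbb{P}^{n-1}(\mathbb{F}_{p^j})|\right)$$ converges absolutely, and $$P_R(R,\ell)^{-1}=\zeta_G(\ell).$$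 -/

import Mathlib

open scoped ENNReal TensorProduct LinearAlgebra.Projectivization

universe u

noncomputable section

/-! ### Absolutely irreducible representations over finite fields -/

section Representations

variable {G : Type u} [Group G] {F : Type} [Field F]

/-- The base change `F̄ ⊗ V` of a representation of `G` on the `F`-vector space `V` to the
algebraic closure of `F`. -/
def baseChangeAlgClosure {V : Type} [AddCommGroup V] [Module F V] (ρ : Representation F G V) :
    Representation (AlgebraicClosure F) G (AlgebraicClosure F ⊗[F] V) :=
  (Module.End.baseChangeHom F (AlgebraicClosure F) V : _ →* _).comp ρ

/-- A representation over `F` is absolutely irreducible if it is irreducible and stays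
irreducible over the algebraic closure of `F`. -/
def IsAbsIrreducible {V : Type} [AddCommGroup V] [Module F V] (ρ : Representation F G V) :
    Prop :=
  ρ.IsIrreducible ∧ (baseChangeAlgClosure ρ).IsIrreducible

variable (G F)

/-- The absolutely irreducible continuous representations of the topological group `G` on `F ^ n`.
The endomorphism ring of `F ^ n` carries the discrete topology, so that continuity means
local constancy. -/
def AbsIrrRep [TopologicalSpace G] (n : ℕ) : Type u :=
  {ρ : Representation F G (Fin n → F) // IsLocallyConstant (ρ : G → _) ∧ IsAbsIrreducible ρ}

/-- Isomorphism of representations. -/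
def absIrrRepSetoid [TopologicalSpace G] (n : ℕ) : Setoid (AbsIrrRep G F n) where
  r ρ σ := Nonempty (ρ.1.Equiv σ.1)
  iseqv :=
    { refl := fun ρ => ⟨Representation.Equiv.refl ρ.1⟩
      symm := fun ⟨e⟩ => ⟨e.symm⟩
      trans := fun ⟨e⟩ ⟨f⟩ => ⟨e.trans f⟩ }

/-- `r*(G, F, n)`: the number (possibly `∞`) of isomorphism classes of absolutely irreducible
continuous `n`-dimensional representations of `G` over `F`. -/
def rStar [TopologicalSpace G] (n : ℕ) : ℕ∞ :=
  ENat.card (Quotient (absIrrRepSetoid G F n))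

end Representations

/-- `G` has uniformly bounded exponential representation growth over finite fields (UBERG):
there is `c > 0` with `r*(G, F, n) ≤ |F| ^ (c n)` for all finite fields `F` and all `n`. -/
def UBERG (G : Type u) [Group G] [TopologicalSpace G] : Prop :=
  ∃ c : ℝ, 0 < c ∧ ∀ (F : Type) [Field F] [Finite F] (n : ℕ),
    (rStar G F n : ℝ≥0∞) ≤ (Nat.card F : ℝ≥0∞) ^ (c * n)

/-! ### The zeta function -/

/-- The term of index `(p, n, j)` of the series defining `log ζ_G(s)`, that is
`r*(G, 𝔽_{p^j}, n) / j * p ^ (-s n j) * |ℙ^{n-1}(𝔽_{p^j})|`. -/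
def zetaTerm (G : Type u) [Group G] [TopologicalSpace G] (s : ℂ)
    (t : Nat.Primes × ℕ+ × ℕ+) : ℂ :=
  let p : ℕ := t.1
  let n : ℕ := t.2.1
  let j : ℕ := t.2.2
  haveI : Fact p.Prime := ⟨t.1.2⟩
  ((rStar G (GaloisField p j) n).toNat : ℂ) / (j : ℂ) * (p : ℂ) ^ (-(s * n * j)) *
    (Nat.card (ℙ (GaloisField p j) (Fin n → GaloisField p j)) : ℂ)

/-- The zeta function `ζ_G`, meaningful at those `s` where the series converges. -/
def zetaG (G : Type u) [Group G] [TopologicalSpace G] (s : ℂ) : ℂ :=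
  Complex.exp (∑' t, zetaTerm G s t)

/-! ### The completed group ring `Ẑ⟦G⟧` -/

section CompletedGroupRing

variable (G : Type u) [Group G] [TopologicalSpace G]

/-- The index set of the inverse system: an open normal subgroup and a positive modulus. -/
abbrev CGRIndex : Type u := OpenNormalSubgroup G × ℕ+

variable {G}

/-- The finite group ring `(ℤ/m)[G/N]`. -/
abbrev finiteLevel (i : CGRIndex G) : Type u :=
  MonoidAlgebra (ZMod (i.2 : ℕ)) (G ⧸ i.1.toSubgroup)

/-- The natural projection `(ℤ/m)[G/N] → (ℤ/m')[G/N']` for `N ≤ N'` and `m' ∣ m`. -/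
def levelMap (i i' : CGRIndex G) (hN : i.1.toSubgroup ≤ i'.1.toSubgroup)
    (hm : (i'.2 : ℕ) ∣ (i.2 : ℕ)) : finiteLevel i →+* finiteLevel i' :=
  (MonoidAlgebra.mapRingHom (G ⧸ i'.1.toSubgroup) (ZMod.castHom hm (ZMod (i'.2 : ℕ)))).comp
    (MonoidAlgebra.mapDomainRingHom (ZMod (i.2 : ℕ))
      (QuotientGroup.map i.1.toSubgroup i'.1.toSubgroup (MonoidHom.id G) hN))

variable (G)

/-- The compatible families in the product of the rings `(ℤ/m)[G/N]`. -/
def completedGroupSubring : Subring (∀ i : CGRIndex G, finiteLevel i) where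
  carrier := {x | ∀ (i i' : CGRIndex G) (hN : i.1.toSubgroup ≤ i'.1.toSubgroup)
    (hm : (i'.2 : ℕ) ∣ (i.2 : ℕ)), levelMap i i' hN hm (x i) = x i'}
  mul_mem' := fun hx hy i i' hN hm => by simp [hx i i' hN hm, hy i i' hN hm]
  one_mem' := fun i i' hN hm => by simp
  add_mem' := fun hx hy i i' hN hm => by simp [hx i i' hN hm, hy i i' hN hm]
  zero_mem' := fun i i' hN hm => by simp
  neg_mem' := fun hx i i' hN hm => by simp [hx i i' hN hm]

/-- The completed group ring `Ẑ⟦G⟧`, the inverse limit of the rings `(ℤ/m)[G/N]` over all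
open normal subgroups `N` of `G` and all `m ≥ 1`. -/
def CompletedGroupRing : Type u := completedGroupSubring G

instance : Ring (CompletedGroupRing G) :=
  inferInstanceAs (Ring (completedGroupSubring G))

/-- Every finite level carries the discrete topology. -/
local instance finiteLevelTopology (i : CGRIndex G) : TopologicalSpace (finiteLevel i) := ⊥

local instance finiteLevelDiscrete (i : CGRIndex G) : DiscreteTopology (finiteLevel i) := ⟨rfl⟩

/-- The inverse limit topology: the subspace topology in the product of the discrete rings. -/
instance : TopologicalSpace (CompletedGroupRing G) :=
  inferInstanceAs (TopologicalSpace (completedGroupSubring G))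

instance : IsTopologicalRing (CompletedGroupRing G) :=
  inferInstanceAs (IsTopologicalRing (completedGroupSubring G))

theorem finite_finiteLevel [IsTopologicalGroup G] [CompactSpace G] (i : CGRIndex G) :
    Finite (finiteLevel i) := by
  have : Finite (G ⧸ i.1.toSubgroup) :=
    Subgroup.quotient_finite_of_isOpen _ i.1.toOpenSubgroup.isOpen
  have : NeZero (i.2 : ℕ) := ⟨i.2.ne_zero⟩
  have : Finite (ZMod (i.2 : ℕ)) := inferInstance
  exact Module.finite_of_finite (ZMod (i.2 : ℕ))

theorem isClosed_completedGroupSubring :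
    IsClosed (completedGroupSubring G : Set (∀ i : CGRIndex G, finiteLevel i)) := by
  have h : (completedGroupSubring G : Set (∀ i : CGRIndex G, finiteLevel i)) =
      ⋂ (i : CGRIndex G) (i' : CGRIndex G) (hN : i.1.toSubgroup ≤ i'.1.toSubgroup)
        (hm : (i'.2 : ℕ) ∣ (i.2 : ℕ)), {x | levelMap i i' hN hm (x i) = x i'} := by
    ext x
    simp only [Set.mem_iInter]
    rfl
  rw [h]
  refine isClosed_iInter fun i => isClosed_iInter fun i' => isClosed_iInter fun hN =>
    isClosed_iInter fun hm => ?_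
  exact isClosed_eq (continuous_of_discreteTopology.comp (continuous_apply i))
    (continuous_apply i')

instance [IsTopologicalGroup G] [CompactSpace G] : CompactSpace (CompletedGroupRing G) := by
  have : ∀ i : CGRIndex G, Finite (finiteLevel i) := finite_finiteLevel G
  exact isCompact_iff_compactSpace.mp (isClosed_completedGroupSubring G).isCompact

end CompletedGroupRing

/-! ### The generation probability -/

/-- `P_R(R, ℓ)` for a compact topological ring `R`: the normalised Haar measure on `R ^ ℓ`
of the set of `ℓ`-tuples that generate `R` as a left `R`-module. -/
def generationProb (R : Type u) [Ring R] [TopologicalSpace R] [IsTopologicalRing R]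
    [CompactSpace R] (ℓ : ℕ) : ℝ :=
  letI : MeasurableSpace (Fin ℓ → R) := borel _
  haveI : BorelSpace (Fin ℓ → R) := ⟨rfl⟩
  (MeasureTheory.Measure.addHaarMeasure (⊤ : TopologicalSpace.PositiveCompacts (Fin ℓ → R))).real
    {x | Submodule.span R (Set.range x) = ⊤}

end

/-! By compactness a tuple generates $R$ iff it generates every finite level
$A=(\mathbb{Z}/m)[G/N]$, so $P_R(R,\ell)$ is the limit of the probabilities of generating the
levels. Modulo its Jacobson radical, $A$ is a product of matrix rings $M_{d_k}(K_k)$ over finite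
fields, and by Nakayama only this quotient matters. Over $M_d(K)$ with $|K|=q$, an $\ell$-tuple
generates iff the stacked $\ell d\times d$ matrix has rank $d$, which has probability
$\prod_{t<d}(1-q^{t-\ell d})$.

Expanding $-\log$ gives $\sum_m \frac1m q^{-\ell dm}|\mathbb{P}^{d-1}(\mathbb{F}_{q^m})|$. If
$q=p^a$ and $j=am$, then $\frac1m=\frac aj$, and $a$ is the number of embeddings
$K\to\mathbb{F}_{p^j}$ (`hasSum_zetaWeight_of_finite_field`). Pairs of a factor $k$ with $d_k=n$ and
an embedding $K_k\to F$ correspond to the absolutely irreducible $n$-dimensional representations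
over $F$ that factor through the level (`card_levelClasses`). So each level contributes the zeta
series restricted to its own representations (`measureReal_generatesAtLevel`). UBERG makes the full
series converge for large $\ell$; it dominates the restricted ones, so they tend to it
(`tendsto_tsum_levelClasses`). -/

noncomputable section

/-! ### Generating tuples over finite rings. -/

section GeneratingTuples

theorem span_range_eq_top_iff_exists_sum {R : Type*} [Ring R] {ι : Type*} [Fintype ι]
    (x : ι → R) :
    Submodule.span R (Set.range x) = ⊤ ↔ ∃ c : ι → R, ∑ i, c i * x i = 1 := by
  rw [← Ideal.span, Ideal.eq_top_iff_one, Ideal.span, Submodule.mem_span_range_iff_exists_fun]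
  rfl

/-- Nakayama: if the $x_i$ lay in a maximal left ideal $M$, a lifted relation would differ from 1 by
an element of the radical, which is inside $M$, so $1\in M$. -/
theorem exists_sum_eq_one_iff_of_surjective {A B : Type*} [Ring A] [Ring B] (f : A →+* B)
    (hf : Function.Surjective f) (hker : ∀ a, f a = 0 → a ∈ Ring.jacobson A)
    {ι : Type*} [Fintype ι] (x : ι → A) :
    (∃ c : ι → A, ∑ i, c i * x i = 1) ↔ ∃ c : ι → B, ∑ i, c i * f (x i) = 1 := by
  constructor
  · rintro ⟨c, hc⟩
    exact ⟨fun i => f (c i), by simpa using congrArg f hc⟩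
  · rintro ⟨c, hc⟩
    choose g hg using hf
    rw [← span_range_eq_top_iff_exists_sum]
    by_contra hne
    obtain ⟨M, hM, hle⟩ := Ideal.exists_le_maximal (Ideal.span (Set.range x)) hne
    apply hM.ne_top
    rw [Ideal.eq_top_iff_one]
    have h1 : ∑ i, g (c i) * x i ∈ M :=
      sum_mem fun i _ => M.mul_mem_left _ (hle (Ideal.subset_span ⟨i, rfl⟩))
    have h2 : 1 - ∑ i, g (c i) * x i ∈ M :=
      Ring.jacobson_le_of_isMaximal M (hker _ (by simp [hg, hc]))
    simpa using add_mem h2 h1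

theorem exists_sum_eq_one_pi_iff {κ : Type*} {B : κ → Type*} [∀ k, Ring (B k)]
    {ι : Type*} [Fintype ι] (x : ι → ∀ k, B k) :
    (∃ c : ι → ∀ k, B k, ∑ i, c i * x i = 1) ↔
      ∀ k, ∃ c : ι → B k, ∑ i, c i * x i k = 1 := by
  constructor
  · rintro ⟨c, hc⟩ k
    exact ⟨fun i => c i k, by simpa using congrFun hc k⟩
  · intro h
    choose c hc using h
    exact ⟨fun i k => c k i, by ext1 k; simpa using hc k⟩

/-- Stacking `ℓ` square matrices of size `d` on top of each other and reading off the columns. -/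
def stackColumns (K : Type*) (ℓ d : ℕ) :
    (Fin ℓ → Matrix (Fin d) (Fin d) K) ≃ (Fin d → (Fin ℓ × Fin d → K)) where
  toFun x j p := x p.1 p.2 j
  invFun s i r j := s j (i, r)
  left_inv _ := rfl
  right_inv _ := rfl

/-- Placed side by side, the coefficients $c_i$ form a left inverse of the stacked matrix $X$; one
exists iff $X$ is injective. -/
theorem exists_sum_mul_eq_one_iff_linearIndependent {K : Type*} [Field K] {ℓ d : ℕ}
    (x : Fin ℓ → Matrix (Fin d) (Fin d) K) :
    (∃ c : Fin ℓ → Matrix (Fin d) (Fin d) K, ∑ i, c i * x i = 1) ↔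
      LinearIndependent K (stackColumns K ℓ d x) := by
  let X : Matrix (Fin ℓ × Fin d) (Fin d) K := Matrix.of fun p j => x p.1 p.2 j
  have h1 : LinearIndependent K (stackColumns K ℓ d x) ↔ LinearIndependent K X.col := Iff.rfl
  rw [h1, ← Matrix.mulVec_injective_iff]
  constructor
  · rintro ⟨c, hc⟩
    let C : Matrix (Fin d) (Fin ℓ × Fin d) K := Matrix.of fun r p => c p.1 r p.2
    have hCX : C * X = 1 := by
      rw [← hc]
      ext r j
      simp [Matrix.mul_apply, C, X, Fintype.sum_prod_type, Matrix.sum_apply]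
    exact Function.HasLeftInverse.injective
      ⟨C.mulVec, fun v => by rw [Matrix.mulVec_mulVec, hCX, Matrix.one_mulVec]⟩
  · intro h
    obtain ⟨g, hg⟩ := X.mulVecLin.exists_leftInverse_of_injective
      (LinearMap.ker_eq_bot.2 h)
    have hC : LinearMap.toMatrix' g * X = 1 := by
      rw [← LinearMap.toMatrix'_id, ← hg, LinearMap.toMatrix'_comp, ← Matrix.toLin'_apply',
        LinearMap.toMatrix'_toLin']
    refine ⟨fun i => Matrix.of fun r t => LinearMap.toMatrix' g r (i, t), ?_⟩
    rw [← hC]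
    ext r j
    simp [Matrix.mul_apply, X, Fintype.sum_prod_type, Matrix.sum_apply]

theorem card_generating_matrix_tuples {K : Type*} [Field K] [Finite K] {ℓ d : ℕ} (hℓ : 1 ≤ ℓ) :
    (Nat.card {x : Fin ℓ → Matrix (Fin d) (Fin d) K //
      ∃ c : Fin ℓ → Matrix (Fin d) (Fin d) K, ∑ i, c i * x i = 1} : ℝ) /
        Nat.card (Fin ℓ → Matrix (Fin d) (Fin d) K) =
      ∏ t ∈ Finset.range d, (1 - (Nat.card K : ℝ) ^ t / (Nat.card K : ℝ) ^ (ℓ * d)) := by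
  have := Fintype.ofFinite K
  have h1 : Nat.card {x : Fin ℓ → Matrix (Fin d) (Fin d) K //
      ∃ c : Fin ℓ → Matrix (Fin d) (Fin d) K, ∑ i, c i * x i = 1} =
      Nat.card {s : Fin d → (Fin ℓ × Fin d → K) // LinearIndependent K s} :=
    Nat.card_congr ((stackColumns K ℓ d).subtypeEquiv
      fun x => exists_sum_mul_eq_one_iff_linearIndependent x)
  -- This is where $\ell\ge 1$ enters: the count $\prod_{t<d}(q^{\ell d}-q^t)$ of independent
  -- families needs $d\le\ell d$.
  have hle : d ≤ ℓ * d := Nat.le_mul_of_pos_left d hℓ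
  have hq : 1 ≤ Nat.card K := Nat.card_pos
  rw [h1, card_linearIndependent (by simpa using hle), Nat.card_congr (stackColumns K ℓ d),
    Nat.card_fun, Nat.card_fun, Finset.prod_range]
  simp only [Module.finrank_fintype_fun_eq_card, Fintype.card_prod, Fintype.card_fin,
    Nat.card_prod, Nat.card_eq_fintype_card (α := Fin _)]
  have h2 : ((Nat.card K ^ (ℓ * d)) ^ d : ℕ) = ∏ _t : Fin d, Nat.card K ^ (ℓ * d) := by simp
  rw [h2, Nat.cast_prod, Nat.cast_prod, ← Finset.prod_div_distrib]
  refine Finset.prod_congr rfl fun t _ => ?_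
  have hq' : (0 : ℝ) < Nat.card K := by exact_mod_cast hq
  rw [Nat.cast_sub, ← Nat.card_eq_fintype_card, sub_div, Nat.cast_pow, Nat.cast_pow,
    div_self (by positivity)]
  rw [← Nat.card_eq_fintype_card]
  exact Nat.pow_le_pow_right hq (t.2.le.trans hle)

theorem card_generating_pi_tuples {κ : Type*} [Fintype κ] {B : κ → Type*} [∀ k, Ring (B k)]
    [∀ k, Finite (B k)] {ℓ : ℕ} :
    (Nat.card {x : Fin ℓ → ∀ k, B k // ∃ c : Fin ℓ → ∀ k, B k, ∑ i, c i * x i = 1} : ℝ) /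
        Nat.card (Fin ℓ → ∀ k, B k) =
      ∏ k, (Nat.card {x : Fin ℓ → B k // ∃ c : Fin ℓ → B k, ∑ i, c i * x i = 1} : ℝ) /
        Nat.card (Fin ℓ → B k) := by
  have e1 : {x : Fin ℓ → ∀ k, B k // ∃ c : Fin ℓ → ∀ k, B k, ∑ i, c i * x i = 1} ≃
      ∀ k, {x : Fin ℓ → B k // ∃ c : Fin ℓ → B k, ∑ i, c i * x i = 1} :=
    ((Equiv.piComm fun _ k => B k).subtypeEquiv fun x => exists_sum_eq_one_pi_iff x).trans
      (Equiv.subtypePiEquivPi (p := fun k (x : Fin ℓ → B k) =>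
        ∃ c : Fin ℓ → B k, ∑ i, c i * x i = 1))
  rw [Nat.card_congr e1, Nat.card_congr (Equiv.piComm fun _ k => B k), Nat.card_pi, Nat.card_pi,
    Nat.cast_prod, Nat.cast_prod, Finset.prod_div_distrib]

end GeneratingTuples

/-- A finite ring modulo its Jacobson radical is a product of matrix rings over finite fields. -/
theorem exists_surjective_pi_matrix (A : Type u) [Ring A] [Finite A] :
    ∃ (s : ℕ) (K : Fin s → Type u) (d : Fin s → ℕ) (_ : ∀ k, Field (K k))
      (π : A →+* ∀ k, Matrix (Fin (d k)) (Fin (d k)) (K k)),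
      (∀ k, Finite (K k)) ∧ (∀ k, NeZero (d k)) ∧ Function.Surjective π ∧
        ∀ a, π a = 0 ↔ a ∈ Ring.jacobson A := by
  have : IsSemisimpleRing (A ⧸ Ring.jacobson A) := IsSemiprimaryRing.isSemisimpleRing
  obtain ⟨s, D, d, _, hd, ⟨e⟩⟩ :=
    IsSemisimpleRing.exists_ringEquiv_pi_matrix_divisionRing (A ⧸ Ring.jacobson A)
  have hfin : ∀ k, Finite (D k) := fun k => by
    have : Finite (A ⧸ Ring.jacobson A) :=
      Finite.of_surjective _ (Ideal.Quotient.mk_surjective (I := Ring.jacobson A))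
    have : Finite (∀ k, Matrix (Fin (d k)) (Fin (d k)) (D k)) := Finite.of_equiv _ e.toEquiv
    -- The division ring embeds as constant matrices in one factor, so it is finite, hence a field
    -- by Wedderburn's little theorem.
    refine Finite.of_injective (β := ∀ k, Matrix (Fin (d k)) (Fin (d k)) (D k))
      (fun c => Pi.single k (Matrix.of fun _ _ => c)) fun a b h => ?_
    have := congrFun h k
    simp only [Pi.single_eq_same] at this
    have hk := hd k
    exact congrFun (congrFun this 0) 0
  let inst : ∀ k, Field (D k) := fun k => littleWedderburn (D k)
  refine ⟨s, D, d, inst, (e : _ →+* _).comp (Ideal.Quotient.mk (Ring.jacobson A)), hfin, hd,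
    e.surjective.comp Ideal.Quotient.mk_surjective, fun a => ?_⟩
  rw [RingHom.comp_apply, ← Ideal.Quotient.eq_zero_iff_mem]
  exact map_eq_zero_iff _ e.injective

/-! ### Modules over products of matrix rings with scalar endomorphisms. -/

section MatrixModel

variable {F : Type*} [Field F] {V : Type*} [AddCommGroup V] [Module F V]

/-- A ring homomorphism to `End V` acts irreducibly, with only scalars commuting with it. -/
structure IsCentrallyIrreducible {A : Type*} [Ring A] (φ : A →+* Module.End F V) : Prop where
  nontrivial : Nontrivial V
  eq_bot_or_eq_top : ∀ W : Submodule F V, (∀ a, ∀ w ∈ W, φ a w ∈ W) → W = ⊥ ∨ W = ⊤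
  exists_smul_one : ∀ T : Module.End F V, (∀ a, T * φ a = φ a * T) →
    ∃ c : F, T = algebraMap F (Module.End F V) c

/-- The action of the `k`-th matrix factor on a vector space with basis `b`, through an embedding
`σ` of its field of coefficients. -/
def matrixModel {A : Type*} [Ring A] {κ : Type*} {K : κ → Type*} {d : κ → ℕ} [∀ k, Field (K k)]
    (π : A →+* ∀ k, Matrix (Fin (d k)) (Fin (d k)) (K k)) (k : κ) (σ : K k →+* F)
    (b : Module.Basis (Fin (d k)) F V) : A →+* Module.End F V :=
  (Matrix.toLinAlgEquiv b : _ →+* Module.End F V).comp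
    (σ.mapMatrix.comp ((Pi.evalRingHom _ k).comp π))

theorem matrixModel_apply {A : Type*} [Ring A] {κ : Type*} {K : κ → Type*} {d : κ → ℕ}
    [∀ k, Field (K k)] (π : A →+* ∀ k, Matrix (Fin (d k)) (Fin (d k)) (K k)) (k : κ)
    (σ : K k →+* F) (b : Module.Basis (Fin (d k)) F V) (a : A) :
    matrixModel π k σ b a = Matrix.toLinAlgEquiv b ((π a k).map σ) := rfl

/-- Scalar matrices commute with the action, so they act through elements of $F$; this defines
$\sigma$. The basis is $E_{i i_0}v$ for a $v$ with $E_{i_0i_0}v\neq 0$: matrix units separate these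
vectors, and their span is stable, hence everything. -/
theorem IsCentrallyIrreducible.exists_basis_of_matrix {K : Type*} [Field K] {d : ℕ}
    {χ : Matrix (Fin d) (Fin d) K →+* Module.End F V} (h : IsCentrallyIrreducible χ) :
    ∃ (σ : K →+* F) (b : Module.Basis (Fin d) F V),
      ∀ M, χ M = Matrix.toLinAlgEquiv b (M.map σ) := by
  have := h.nontrivial
  have hinj : Function.Injective (algebraMap F (Module.End F V)) :=
    FaithfulSMul.algebraMap_injective _ _
  have hs : ∀ c : K, ∃ x : F, χ (Matrix.scalar (Fin d) c) = algebraMap F (Module.End F V) x :=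
    fun c => h.exists_smul_one _ fun M => by
      rw [← map_mul, ← map_mul, (Matrix.scalar_commute c (fun r => mul_comm _ _) M).eq]
  choose σ₀ hσ₀ using hs
  let σ : K →+* F :=
    { toFun := σ₀
      map_one' := hinj (by rw [← hσ₀]; simp)
      map_zero' := hinj (by rw [← hσ₀]; simp)
      map_mul' := fun x y => hinj (by rw [map_mul, ← hσ₀, ← hσ₀, ← hσ₀, map_mul, map_mul])
      map_add' := fun x y => hinj (by rw [map_add, ← hσ₀, ← hσ₀, ← hσ₀, map_add, map_add]) }
  have hσ : ∀ c, χ (Matrix.scalar (Fin d) c) = algebraMap F (Module.End F V) (σ c) := hσ₀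
  have hsum : ∑ i, χ (Matrix.single i i 1) = 1 := by
    rw [← map_sum, Matrix.sum_single_one, map_one]
  obtain ⟨i₀, hi₀⟩ : ∃ i, χ (Matrix.single i i 1) ≠ 0 := by
    by_contra! hc
    simp [hc] at hsum
  obtain ⟨v, hv⟩ : ∃ v, χ (Matrix.single i₀ i₀ 1) v ≠ 0 := by
    by_contra! hc
    exact hi₀ (LinearMap.ext hc)
  let b₀ : Fin d → V := fun i => χ (Matrix.single i i₀ 1) v
  have hE : ∀ i j l, χ (Matrix.single i j 1) (b₀ l) = if j = l then b₀ i else 0 := by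
    intro i j l
    rw [← Module.End.mul_apply, ← map_mul]
    split_ifs with hjl
    · subst hjl; simp [b₀]
    · simp [Matrix.single_mul_single_of_ne, hjl]
  have hb₀ : ∀ i, b₀ i ≠ 0 := fun i hi => hv (by
    have := hE i₀ i i
    rw [hi, map_zero, if_pos rfl] at this
    exact this.symm)
  have hM : ∀ M l, χ M (b₀ l) = ∑ i, σ (M i l) • b₀ i := by
    intro M l
    have h1 : M = ∑ i, ∑ j, Matrix.scalar (Fin d) (M i j) * Matrix.single i j 1 := by
      conv_lhs => rw [Matrix.matrix_eq_sum_single M]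
      simp [← Matrix.smul_eq_diagonal_mul, Matrix.smul_single]
    conv_lhs => rw [h1]
    simp only [map_sum, map_mul, LinearMap.sum_apply, Module.End.mul_apply, hE, hσ,
      Module.algebraMap_end_apply, smul_ite, smul_zero]
    simp
  have hli : LinearIndependent F b₀ := by
    rw [Fintype.linearIndependent_iff]
    intro g hg i
    have := congrArg (χ (Matrix.single i i 1)) hg
    simp only [map_sum, map_smul, hE, map_zero] at this
    simpa [hb₀ i] using this
  have hspan : ⊤ ≤ Submodule.span F (Set.range b₀) := by
    rcases h.eq_bot_or_eq_top (Submodule.span F (Set.range b₀)) (fun M w hw => by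
      induction hw using Submodule.span_induction with
      | mem x hx =>
        obtain ⟨l, rfl⟩ := hx
        rw [hM]
        exact sum_mem fun i _ => Submodule.smul_mem _ _ (Submodule.subset_span ⟨i, rfl⟩)
      | zero => simp
      | add x y _ _ hx hy => rw [map_add]; exact add_mem hx hy
      | smul c x _ hx => rw [map_smul]; exact Submodule.smul_mem _ _ hx) with h1 | h1
    · exact absurd (Submodule.span_eq_bot.1 h1 _ ⟨i₀, rfl⟩) (hb₀ i₀)
    · exact h1.ge
  refine ⟨σ, Module.Basis.mk hli hspan, fun M => (Module.Basis.mk hli hspan).ext fun l => ?_⟩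
  rw [Matrix.toLinAlgEquiv_self]
  simp [hM]

/-- Each central idempotent acts as an idempotent scalar, that is 0 or 1. Since they sum to 1, some
factor's unit acts as 1, and the action factors through that factor. -/
theorem IsCentrallyIrreducible.exists_eq_matrixModel_id {κ : Type*} [Fintype κ] [DecidableEq κ]
    {K : κ → Type*} {d : κ → ℕ} [∀ k, Field (K k)]
    {ψ : (∀ k, Matrix (Fin (d k)) (Fin (d k)) (K k)) →+* Module.End F V}
    (h : IsCentrallyIrreducible ψ) :
    ∃ (k : κ) (σ : K k →+* F) (b : Module.Basis (Fin (d k)) F V),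
      ψ = matrixModel (RingHom.id _) k σ b := by
  have := h.nontrivial
  have hinj : Function.Injective (algebraMap F (Module.End F V)) :=
    FaithfulSMul.algebraMap_injective _ _
  let ε : ∀ k, ∀ k, Matrix (Fin (d k)) (Fin (d k)) (K k) := fun k => Pi.single k 1
  have hcomm : ∀ k a, ε k * a = Pi.single k (a k) ∧ a * ε k = Pi.single k (a k) := fun k a => by
    constructor <;>
    · ext1 j
      by_cases hj : j = k
      · subst hj; simp [ε]
      · simp [ε, Pi.single_eq_of_ne hj]
  have hsum : ∑ k, ψ (ε k) = 1 := by
    rw [← map_sum, ← map_one ψ]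
    congr 1
    exact Finset.univ_sum_single (1 : ∀ k, Matrix (Fin (d k)) (Fin (d k)) (K k))
  obtain ⟨k, hk⟩ : ∃ k, ψ (ε k) ≠ 0 := by
    by_contra! hc
    simp [hc] at hsum
  have hone : ψ (ε k) = 1 := by
    obtain ⟨c, hc⟩ := h.exists_smul_one (ψ (ε k)) fun a => by
      rw [← map_mul, ← map_mul, (hcomm k a).1, (hcomm k a).2]
    have hidem : ψ (ε k) * ψ (ε k) = ψ (ε k) := by
      rw [← map_mul, (hcomm k (ε k)).1]; simp [ε]
    rw [hc, ← map_mul] at hidem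
    have hcc := hinj hidem
    have hc0 : c ≠ 0 := fun h0 => hk (by rw [hc, h0, map_zero])
    rw [hc, (IsIdempotentElem.iff_eq_zero_or_one.1 hcc).resolve_left hc0, map_one]
  let χ : Matrix (Fin (d k)) (Fin (d k)) (K k) →+* Module.End F V :=
    { toFun := fun M => ψ (Pi.single k M)
      map_one' := hone
      map_zero' := by simp
      map_mul' := fun M N => by rw [Pi.single_mul, map_mul]
      map_add' := fun M N => by rw [Pi.single_add, map_add] }
  have hχ : ∀ a, ψ a = χ (a k) := fun a => by
    change ψ a = ψ (Pi.single k (a k))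
    rw [← (hcomm k a).1, map_mul, hone, one_mul]
  have hχirr : IsCentrallyIrreducible χ :=
    ⟨h.nontrivial, fun W hW => h.eq_bot_or_eq_top W fun a => by rw [hχ]; exact hW _,
      fun T hT => h.exists_smul_one T fun a => by rw [hχ]; exact hT _⟩
  obtain ⟨σ, b, hσ⟩ := hχirr.exists_basis_of_matrix
  exact ⟨k, σ, b, RingHom.ext fun a => by rw [hχ, hσ]; rfl⟩

/-- With $J$ the radical, $JV$ is a proper submodule by Nakayama. It is also an $F$-subspace,
because $A$ acts $F$-linearly, so irreducibility forces $JV=0$. -/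
theorem IsCentrallyIrreducible.map_jacobson_eq_zero {A : Type*} [Ring A] [Finite V]
    {φ : A →+* Module.End F V} (h : IsCentrallyIrreducible φ) {a : A}
    (ha : a ∈ Ring.jacobson A) : φ a = 0 := by
  have := h.nontrivial
  let _ : Module A V := Module.compHom V φ
  have hsm : ∀ (a : A) (v : V), a • v = φ a v := fun _ _ => rfl
  have hlt : Ring.jacobson A • (⊤ : Submodule A V) < ⊤ := Submodule.jacobson_smul_lt_top ⊤
  let W : Submodule F V :=
    { (Ring.jacobson A • (⊤ : Submodule A V)).toAddSubmonoid with
      smul_mem' := fun c v hv => by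
        change c • v ∈ Ring.jacobson A • (⊤ : Submodule A V)
        refine Submodule.smul_induction_on (p := fun v => c • v ∈ _) hv (fun r hr n _ => ?_)
          fun x y hx hy => ?_
        · have : c • r • n = r • c • n := by rw [hsm, hsm, map_smul]
          rw [this]
          exact Submodule.smul_mem_smul hr trivial
        · rw [smul_add]; exact add_mem hx hy }
  have hW : ∀ v, v ∈ W ↔ v ∈ Ring.jacobson A • (⊤ : Submodule A V) := fun v => Iff.rfl
  rcases h.eq_bot_or_eq_top W (fun a w hw => Submodule.smul_mem _ a ((hW w).1 hw)) with h1 | h1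
  · ext v
    have : φ a v ∈ W := (hW _).2 (Submodule.smul_mem_smul (n := v) ha trivial)
    rw [h1] at this
    exact (Submodule.mem_bot F).1 this
  · exact absurd ((Submodule.eq_top_iff').2 fun v => (hW v).1 (h1 ▸ trivial)) hlt.ne

theorem IsCentrallyIrreducible.exists_eq_matrixModel {A : Type*} [Ring A] [Finite V]
    {κ : Type*} [Fintype κ] {K : κ → Type*} {d : κ → ℕ} [∀ k, Field (K k)]
    {π : A →+* ∀ k, Matrix (Fin (d k)) (Fin (d k)) (K k)} (hπ : Function.Surjective π)
    (hker : ∀ a, π a = 0 ↔ a ∈ Ring.jacobson A)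
    {φ : A →+* Module.End F V} (h : IsCentrallyIrreducible φ) :
    ∃ (k : κ) (σ : K k →+* F) (b : Module.Basis (Fin (d k)) F V), φ = matrixModel π k σ b := by
  classical
  let ψ := RingHom.liftOfSurjective π hπ ⟨φ, fun a ha =>
    h.map_jacobson_eq_zero ((hker a).1 ha)⟩
  have hψ : ∀ a, ψ (π a) = φ a := fun a => RingHom.liftOfRightInverse_comp_apply _ _ _ _ a
  have hψirr : IsCentrallyIrreducible ψ :=
    ⟨h.nontrivial, fun W hW => h.eq_bot_or_eq_top W fun a => by rw [← hψ]; exact hW _,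
      fun T hT => h.exists_smul_one T fun a => by rw [← hψ]; exact hT _⟩
  obtain ⟨k, σ, b, hσ⟩ := hψirr.exists_eq_matrixModel_id
  exact ⟨k, σ, b, RingHom.ext fun a => by rw [← hψ, hσ]; rfl⟩

/-- The unit of factor $k$ acts as 1 on its own model and as 0 on the others, which recovers $k$;
scalar matrices in that factor then recover $\sigma$. -/
theorem matrixModel_injective {A : Type*} [Ring A] {V' : Type*} [AddCommGroup V'] [Module F V']
    {κ : Type*} {K : κ → Type*} {d : κ → ℕ} [∀ k, Field (K k)] [∀ k, NeZero (d k)]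
    {π : A →+* ∀ k, Matrix (Fin (d k)) (Fin (d k)) (K k)} (hπ : Function.Surjective π)
    {k k' : κ} {σ : K k →+* F} {σ' : K k' →+* F} (b : Module.Basis (Fin (d k)) F V)
    (b' : Module.Basis (Fin (d k')) F V') (e : V ≃ₗ[F] V')
    (he : ∀ a v, e (matrixModel π k σ b a v) = matrixModel π k' σ' b' a (e v)) :
    (⟨k, σ⟩ : Σ k, K k →+* F) = ⟨k', σ'⟩ := by
  classical
  have hv : b 0 ≠ 0 := b.ne_zero 0
  obtain rfl : k = k' := by
    by_contra hne
    obtain ⟨a, ha⟩ := hπ (Pi.single k 1)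
    have := he a (b 0)
    rw [matrixModel_apply, matrixModel_apply, ha, Pi.single_eq_same,
      Pi.single_eq_of_ne (Ne.symm hne)] at this
    simp [hv] at this
  congr 1
  ext c
  obtain ⟨a, ha⟩ := hπ (Pi.single k (Matrix.scalar _ c))
  have h1 := he a (b 0)
  have hsc : ∀ τ : K k →+* F, ((Matrix.scalar (Fin (d k)) c).map τ) =
      algebraMap F (Matrix (Fin (d k)) (Fin (d k)) F) (τ c) := fun τ => by
    ext i j
    simp [Matrix.algebraMap_matrix_apply, Matrix.diagonal_apply, apply_ite τ]
  rw [matrixModel_apply, matrixModel_apply, ha, Pi.single_eq_same, hsc, hsc,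
    AlgEquiv.commutes, AlgEquiv.commutes, Module.algebraMap_end_apply,
    Module.algebraMap_end_apply, map_smul] at h1
  exact smul_left_injective F (by simpa using hv : e (b 0) ≠ 0) h1

end MatrixModel

/-! ### Absolute irreducibility, spanning of the endomorphism ring, and scalar commutants. -/

section AbsoluteIrreducibility

variable {G : Type u} [Group G]

/-- A stable subspace is stable under every endomorphism, and rank-one maps carry a nonzero vector
anywhere. -/
theorem isIrreducible_of_span_range_eq_top {k V : Type*} [Field k] [AddCommGroup V] [Module k V]
    [Nontrivial V] (ρ : Representation k G V) (h : Submodule.span k (Set.range ρ) = ⊤) :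
    ρ.IsIrreducible := by
  have hW : ∀ (X : Subrepresentation ρ) (T : Module.End k V), ∀ w ∈ X.toSubmodule,
      T w ∈ X.toSubmodule := by
    intro X T w hw
    have hT : T ∈ Submodule.span k (Set.range ρ) := h ▸ trivial
    induction hT using Submodule.span_induction with
    | mem x hx => obtain ⟨g, rfl⟩ := hx; exact X.apply_mem_toSubmodule g hw
    | zero => simp
    | add x y _ _ hx hy => exact add_mem hx hy
    | smul c x _ hx => exact Submodule.smul_mem _ c hx
  have hbt : (⊥ : Subrepresentation ρ) ≠ ⊤ := fun hc => by
    have : (⊥ : Submodule k V) = ⊤ := congrArg Subrepresentation.toSubmodule hc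
    exact bot_ne_top this
  refine { exists_pair_ne := ⟨⊥, ⊤, hbt⟩, eq_bot_or_eq_top := fun X => ?_ }
  by_cases hX : X.toSubmodule = ⊥
  · exact Or.inl (Subrepresentation.toSubmodule_injective hX)
  · right
    obtain ⟨w, hw, hw0⟩ := Submodule.exists_mem_ne_zero_of_ne_bot hX
    refine Subrepresentation.toSubmodule_injective ((Submodule.eq_top_iff').2 fun v => ?_)
    obtain ⟨f, hf⟩ := Module.Projective.exists_dual_eq_one k hw0
    simpa [hf] using hW X (f.smulRight v) w hw

variable {F : Type} [Field F] {V : Type} [AddCommGroup V] [Module F V]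

theorem span_range_baseChange_eq_top [Module.Finite F V] (ρ : Representation F G V)
    (h : Submodule.span F (Set.range ρ) = ⊤) :
    Submodule.span (AlgebraicClosure F) (Set.range (baseChangeAlgClosure ρ)) = ⊤ := by
  classical
  let b := Module.finBasis F V
  have hbc : ∀ T : Module.End F V, T.baseChange (AlgebraicClosure F) ∈
      Submodule.span (AlgebraicClosure F) (Set.range (baseChangeAlgClosure ρ)) := by
    intro T
    have hT : T ∈ Submodule.span F (Set.range ρ) := h ▸ trivial
    induction hT using Submodule.span_induction with
    | mem x hx => obtain ⟨g, rfl⟩ := hx; exact Submodule.subset_span ⟨g, rfl⟩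
    | zero => simp
    | add x y _ _ hx hy => rw [LinearMap.baseChange_add]; exact add_mem hx hy
    | smul c x _ hx =>
      rw [LinearMap.baseChange_smul, ← algebraMap_smul (AlgebraicClosure F) c]
      exact Submodule.smul_mem _ _ hx
  rw [Submodule.eq_top_iff']
  intro T
  let b' := b.baseChange (AlgebraicClosure F)
  have hsingle : ∀ i j, Matrix.toLin b' b' (Matrix.single i j 1) =
      (Matrix.toLin b b (Matrix.single i j 1)).baseChange (AlgebraicClosure F) := by
    intro i j
    refine b'.ext fun l => ?_
    rw [Matrix.toLin_self, Module.Basis.baseChange_apply, LinearMap.baseChange_tmul,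
      Matrix.toLin_self, TensorProduct.tmul_sum]
    refine Finset.sum_congr rfl fun x _ => ?_
    rw [Module.Basis.baseChange_apply, Matrix.single_apply, Matrix.single_apply]
    split_ifs <;> simp
  rw [← (Matrix.toLin b' b').apply_symm_apply T,
    Matrix.matrix_eq_sum_single ((Matrix.toLin b' b').symm T)]
  simp only [map_sum]
  refine Submodule.sum_mem _ fun i _ => Submodule.sum_mem _ fun j _ => ?_
  rw [← mul_one ((Matrix.toLin b' b').symm T i j), ← smul_eq_mul, ← Matrix.smul_single, map_smul,
    hsingle]
  exact Submodule.smul_mem _ _ (hbc _)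

theorem isAbsIrreducible_of_span_range_eq_top [Module.Finite F V] [Nontrivial V]
    (ρ : Representation F G V) (h : Submodule.span F (Set.range ρ) = ⊤) : IsAbsIrreducible ρ := by
  refine ⟨isIrreducible_of_span_range_eq_top ρ h, ?_⟩
  exact isIrreducible_of_span_range_eq_top _ (span_range_baseChange_eq_top ρ h)

/-- Schur's lemma over $\overline F$ makes the base change of $T$ a scalar $c$. A functional $l$
over $F$ with $l(v)=1$ shows $c=l(Tv)\in F$. -/
theorem IsAbsIrreducible.exists_eq_algebraMap [Module.Finite F V] {ρ : Representation F G V}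
    (h : IsAbsIrreducible ρ) (T : Module.End F V) (hT : ∀ g, T * ρ g = ρ g * T) :
    ∃ c : F, T = algebraMap F (Module.End F V) c := by
  rcases subsingleton_or_nontrivial V with hV | hV
  · exact ⟨0, Subsingleton.elim _ _⟩
  have hirr := h.2
  have hcomm : ∀ g, T.baseChange (AlgebraicClosure F) ∘ₗ baseChangeAlgClosure ρ g =
      baseChangeAlgClosure ρ g ∘ₗ T.baseChange (AlgebraicClosure F) := fun g => by
    change T.baseChange _ ∘ₗ (ρ g).baseChange _ = (ρ g).baseChange _ ∘ₗ T.baseChange _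
    rw [← LinearMap.baseChange_comp, ← LinearMap.baseChange_comp]
    exact congrArg _ (hT g)
  let f : (baseChangeAlgClosure ρ).IntertwiningMap (baseChangeAlgClosure ρ) :=
    ⟨T.baseChange (AlgebraicClosure F), hcomm⟩
  obtain ⟨c, hc⟩ :=
    (Representation.IsIrreducible.algebraMap_intertwiningMap_bijective_of_isAlgClosed
      (ρ := baseChangeAlgClosure ρ)).2 f
  have hcT : ∀ v : V, c ⊗ₜ[F] v = (1 : AlgebraicClosure F) ⊗ₜ[F] T v := fun v => by
    have h1 : f (1 ⊗ₜ[F] v) = (1 : AlgebraicClosure F) ⊗ₜ[F] T v := rfl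
    rw [← h1, ← hc]
    change _ = c • ((1 : AlgebraicClosure F) ⊗ₜ[F] v)
    rw [TensorProduct.smul_tmul', smul_eq_mul, mul_one]
  obtain ⟨v, hv⟩ := exists_ne (0 : V)
  obtain ⟨l, hl⟩ := Module.Projective.exists_dual_eq_one F hv
  have hlc : c = algebraMap F (AlgebraicClosure F) (l (T v)) := by
    have := congrArg (TensorProduct.rid F (AlgebraicClosure F) ∘
      (l.lTensor (AlgebraicClosure F))) (hcT v)
    simpa [hl, Algebra.algebraMap_eq_smul_one] using this
  refine ⟨l (T v), LinearMap.ext fun w => ?_⟩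
  have hinj : Function.Injective (fun w : V => (1 : AlgebraicClosure F) ⊗ₜ[F] w) :=
    Module.FaithfullyFlat.tensorProduct_mk_injective V
  apply hinj
  simp only
  rw [← hcT w, hlc, Module.algebraMap_end_apply, Algebra.algebraMap_eq_smul_one,
    TensorProduct.smul_tmul]

theorem IsAbsIrreducible.isCentrallyIrreducible [Module.Finite F V] {ρ : Representation F G V}
    (h : IsAbsIrreducible ρ) {A : Type*} [Ring A] (φ : A →+* Module.End F V)
    (hφ : ∀ g, ∃ a, φ a = ρ g) : IsCentrallyIrreducible φ where
  nontrivial := by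
    by_contra hV
    rw [not_nontrivial_iff_subsingleton] at hV
    have := h.1
    obtain ⟨X, Y, hXY⟩ := exists_pair_ne (Subrepresentation ρ)
    exact hXY (Subrepresentation.toSubmodule_injective (Subsingleton.elim _ _))
  eq_bot_or_eq_top W hW := by
    have := h.1
    let X : Subrepresentation ρ := ⟨W, fun g w hw => by
      obtain ⟨a, ha⟩ := hφ g
      rw [← ha]; exact hW a w hw⟩
    exact (eq_bot_or_eq_top X).imp (congrArg Subrepresentation.toSubmodule)
      (congrArg Subrepresentation.toSubmodule)
  exists_smul_one T hT := h.exists_eq_algebraMap T fun g => by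
    obtain ⟨a, ha⟩ := hφ g
    rw [← ha, hT]

end AbsoluteIrreducibility

/-! ### Representations factoring through a finite level. -/

section FiniteLevels

variable {G : Type u} [Group G] [TopologicalSpace G]

/-- The image of a group element in a finite level of the completed group ring. -/
def levelOf (i : CGRIndex G) : G →* finiteLevel i :=
  (MonoidAlgebra.of (ZMod (i.2 : ℕ)) (G ⧸ i.1.toSubgroup)).comp (QuotientGroup.mk' i.1.toSubgroup)

theorem smul_eq_nsmul_of_finiteLevel (i : CGRIndex G) (r : ZMod (i.2 : ℕ)) (x : finiteLevel i) :
    r • x = r.val • x := by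
  have : NeZero (i.2 : ℕ) := ⟨i.2.ne_zero⟩
  conv_lhs => rw [← ZMod.natCast_zmod_val r]
  rw [Nat.cast_smul_eq_nsmul]

/-- Coefficients in $\mathbb{Z}/m$ are natural multiples of 1, so the image of $G$ generates the
level additively and no scalar case is needed. -/
theorem finiteLevel_induction (i : CGRIndex G) {P : finiteLevel i → Prop}
    (hof : ∀ g, P (levelOf i g)) (hzero : P 0) (hadd : ∀ x y, P x → P y → P (x + y))
    (x : finiteLevel i) : P x := by
  induction x using MonoidAlgebra.induction_on with
  | of g =>
    obtain ⟨g, rfl⟩ := QuotientGroup.mk'_surjective _ g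
    exact hof g
  | add x y hx hy => exact hadd x y hx hy
  | smul r x hx =>
    rw [smul_eq_nsmul_of_finiteLevel]
    induction r.val with
    | zero => rwa [zero_smul]
    | succ n ih => rw [succ_nsmul]; exact hadd _ _ ih hx

variable {F : Type} [Field F] {V : Type} [AddCommGroup V] [Module F V]

/-- The representation of `G` obtained from a module over a finite level. -/
def levelRep (i : CGRIndex G) (φ : finiteLevel i →+* Module.End F V) : Representation F G V :=
  (φ : _ →* _).comp (levelOf i)

theorem levelRep_apply (i : CGRIndex G) (φ : finiteLevel i →+* Module.End F V) (g : G) :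
    levelRep i φ g = φ (levelOf i g) := rfl

theorem le_ker_levelRep (i : CGRIndex G) (φ : finiteLevel i →+* Module.End F V) :
    i.1.toSubgroup ≤ (levelRep i φ).ker := fun g hg => by
  have : QuotientGroup.mk' i.1.toSubgroup g = 1 := (QuotientGroup.eq_one_iff g).2 hg
  rw [MonoidHom.mem_ker, levelRep_apply, levelOf, MonoidHom.comp_apply, this, map_one, map_one]

/-- The action of a finite level attached to a representation that factors through it. -/
def levelAction (i : CGRIndex G) (hi : ((i.2 : ℕ) : F) = 0) (ρ : Representation F G V)
    (hρ : i.1.toSubgroup ≤ ρ.ker) : finiteLevel i →+* Module.End F V :=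
  MonoidAlgebra.liftNCRingHom
    ((algebraMap F (Module.End F V)).comp (ZMod.castHom (ringChar.dvd hi) F))
    (QuotientGroup.lift i.1.toSubgroup ρ hρ) fun x _ =>
      Algebra.commute_algebraMap_left (ZMod.castHom (ringChar.dvd hi) F x) _

theorem levelAction_levelOf (i : CGRIndex G) (hi : ((i.2 : ℕ) : F) = 0)
    (ρ : Representation F G V) (hρ : i.1.toSubgroup ≤ ρ.ker) (g : G) :
    levelAction i hi ρ hρ (levelOf i g) = ρ g := by
  rw [levelAction, levelOf, MonoidHom.comp_apply, MonoidAlgebra.of_apply,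
    MonoidAlgebra.liftNCRingHom_single, map_one, one_mul]
  rfl

theorem isLocallyConstant_of_le_ker [IsTopologicalGroup G] (N : OpenNormalSubgroup G)
    (ρ : Representation F G V) (hρ : N.toSubgroup ≤ ρ.ker) : IsLocallyConstant (ρ : G → _) := by
  rw [IsLocallyConstant.iff_exists_open]
  intro g
  refine ⟨(fun x => g⁻¹ * x) ⁻¹' (N.toSubgroup : Set G),
    N.toOpenSubgroup.isOpen.preimage (continuous_const_mul g⁻¹), by simp [one_mem], ?_⟩
  intro x hx
  have h1 : ρ (g⁻¹ * x) = 1 := hρ hx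
  calc ρ x = ρ (g * (g⁻¹ * x)) := by rw [mul_inv_cancel_left]
    _ = ρ g := by rw [map_mul, h1, mul_one]

section MatrixModel

variable {κ : Type*} {K : κ → Type*} {d : κ → ℕ} [∀ k, Field (K k)]

/-- By surjectivity of $\pi$ the level realises all matrix units of factor $k$, and every element of
the level acts by a sum of group elements. -/
theorem span_range_levelRep_matrixModel (i : CGRIndex G)
    {π : finiteLevel i →+* ∀ k, Matrix (Fin (d k)) (Fin (d k)) (K k)}
    (hπ : Function.Surjective π) (k : κ) (σ : K k →+* F) (b : Module.Basis (Fin (d k)) F V) :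
    Submodule.span F (Set.range (levelRep i (matrixModel π k σ b))) = ⊤ := by
  classical
  have hmem : ∀ a, matrixModel π k σ b a ∈
      Submodule.span F (Set.range (levelRep i (matrixModel π k σ b))) := by
    refine finiteLevel_induction i (fun g => Submodule.subset_span ⟨g, rfl⟩) (by simp) ?_
    intro x y hx hy
    rw [map_add]
    exact add_mem hx hy
  rw [Submodule.eq_top_iff']
  intro T
  rw [← (Matrix.toLinAlgEquiv b).apply_symm_apply T,
    Matrix.matrix_eq_sum_single ((Matrix.toLinAlgEquiv b).symm T)]
  simp only [map_sum]
  refine Submodule.sum_mem _ fun r _ => Submodule.sum_mem _ fun j _ => ?_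
  obtain ⟨a, ha⟩ := hπ (Pi.single k (Matrix.single r j 1))
  have h1 : matrixModel π k σ b a = Matrix.toLinAlgEquiv b (Matrix.single r j 1) := by
    rw [matrixModel_apply, ha, Pi.single_eq_same, Matrix.map_single, map_one]
  rw [← mul_one ((Matrix.toLinAlgEquiv b).symm T r j), ← smul_eq_mul, ← Matrix.smul_single,
    map_smul, ← h1]
  exact Submodule.smul_mem _ _ (hmem a)

theorem equiv_matrixModel_apply {A : Type*} [Ring A] {V' : Type*} [AddCommGroup V'] [Module F V']
    (π : A →+* ∀ k, Matrix (Fin (d k)) (Fin (d k)) (K k)) (k : κ) (σ : K k →+* F)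
    (b : Module.Basis (Fin (d k)) F V) (b' : Module.Basis (Fin (d k)) F V') (a : A) (v : V) :
    b.equiv b' (Equiv.refl _) (matrixModel π k σ b a v) =
      matrixModel π k σ b' a (b.equiv b' (Equiv.refl _) v) := by
  have h : (b.equiv b' (Equiv.refl _)).toLinearMap ∘ₗ matrixModel π k σ b a =
      matrixModel π k σ b' a ∘ₗ (b.equiv b' (Equiv.refl _)).toLinearMap := by
    refine b.ext fun j => ?_
    simp [matrixModel_apply, Matrix.toLinAlgEquiv_self]
  exact LinearMap.congr_fun h v

end MatrixModel

variable (F)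

/-- The isomorphism classes of absolutely irreducible representations which factor through a
given finite level of the completed group ring. -/
def levelClasses (n : ℕ) (i : CGRIndex G) : Set (Quotient (absIrrRepSetoid G F n)) :=
  {q | ((i.2 : ℕ) : F) = 0 ∧ ∃ ρ : AbsIrrRep G F n, (⟦ρ⟧ : Quotient (absIrrRepSetoid G F n)) = q ∧
    i.1.toSubgroup ≤ (ρ.1 : G →* _).ker}

/-- The bijection sends $(k,\sigma)$ to the column space of factor $k$ with scalars extended along
$\sigma$. It is injective by `matrixModel_injective` and surjective by `exists_eq_matrixModel`. -/
theorem card_levelClasses [IsTopologicalGroup G] [Finite F] (n : ℕ) (i : CGRIndex G) {s : ℕ}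
    {K : Fin s → Type u} {d : Fin s → ℕ} [∀ k, Field (K k)] [∀ k, NeZero (d k)]
    {π : finiteLevel i →+* ∀ k, Matrix (Fin (d k)) (Fin (d k)) (K k)}
    (hπ : Function.Surjective π) (hker : ∀ a, π a = 0 ↔ a ∈ Ring.jacobson (finiteLevel i)) :
    Nat.card (levelClasses F n i) = Nat.card {t : Σ k, K k →+* F // d t.1 = n} := by
  let b : ∀ t : {t : Σ k, K k →+* F // d t.1 = n}, Module.Basis (Fin (d t.1.1)) F (Fin n → F) :=
    fun t => (Pi.basisFun F (Fin n)).reindex (finCongr t.2.symm)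
  let φ : ∀ t : {t : Σ k, K k →+* F // d t.1 = n}, finiteLevel i →+* Module.End F (Fin n → F) :=
    fun t => matrixModel π t.1.1 t.1.2 (b t)
  have hirr : ∀ t, IsAbsIrreducible (levelRep i (φ t)) := fun t => by
    have : NeZero n := ⟨t.2 ▸ NeZero.ne _⟩
    exact isAbsIrreducible_of_span_range_eq_top _
      (span_range_levelRep_matrixModel i hπ t.1.1 t.1.2 (b t))
  let ρ : {t : Σ k, K k →+* F // d t.1 = n} → AbsIrrRep G F n := fun t =>
    ⟨levelRep i (φ t), isLocallyConstant_of_le_ker i.1 _ (le_ker_levelRep i _), hirr t⟩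
  have hchar : ∀ t : {t : Σ k, K k →+* F // d t.1 = n}, ((i.2 : ℕ) : F) = 0 := fun t => by
    -- The modulus vanishes in the level, hence in $K_k$ (read off a matrix entry), hence in $F$
    -- through $\sigma$.
    have h1 : ((i.2 : ℕ) : finiteLevel i) = 0 := by
      rw [← nsmul_one, ← Nat.cast_smul_eq_nsmul (ZMod (i.2 : ℕ)), ZMod.natCast_self, zero_smul]
    have h2 := congrArg (fun x => π x t.1.1 0 0) h1
    simp only [map_natCast, map_zero, Pi.natCast_apply, Pi.zero_apply, Matrix.zero_apply] at h2
    rw [← Matrix.diagonal_natCast, Matrix.diagonal_apply_eq] at h2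
    simpa using congrArg t.1.2 h2
  let f : {t : Σ k, K k →+* F // d t.1 = n} → levelClasses F n i := fun t =>
    ⟨⟦ρ t⟧, hchar t, ρ t, rfl, le_ker_levelRep i _⟩
  refine (Nat.card_congr (Equiv.ofBijective f ⟨fun t t' h => ?_, ?_⟩)).symm
  · have h1 : (⟦ρ t⟧ : Quotient (absIrrRepSetoid G F n)) = ⟦ρ t'⟧ := congrArg Subtype.val h
    obtain ⟨e⟩ := Quotient.exact h1
    refine Subtype.ext (matrixModel_injective hπ (b t) (b t') e.toLinearEquiv fun a v => ?_)
    induction a using finiteLevel_induction with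
    | hof g => exact LinearMap.congr_fun (e.isIntertwining' g) v
    | hzero => simp
    | hadd x y hx hy => simp only [map_add, LinearMap.add_apply, hx, hy]
  · rintro ⟨q, hi, τ, rfl, hτ⟩
    have hc := τ.2.2.isCentrallyIrreducible (levelAction i hi τ.1 hτ)
      fun g => ⟨levelOf i g, levelAction_levelOf i hi τ.1 hτ g⟩
    obtain ⟨k, σ, b', hb'⟩ := hc.exists_eq_matrixModel hπ hker
    have hd : d k = n := by
      simpa using (Module.finrank_eq_card_basis b').symm
    refine ⟨⟨⟨k, σ⟩, hd⟩, Subtype.ext (Quotient.sound ?_)⟩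
    refine ⟨Representation.Equiv.mk ((b ⟨⟨k, σ⟩, hd⟩).equiv b' (Equiv.refl _)) fun g =>
      LinearMap.ext fun v => ?_⟩
    have h1 := equiv_matrixModel_apply π k σ (b ⟨⟨k, σ⟩, hd⟩) b' (levelOf i g) v
    rw [← hb', levelAction_levelOf] at h1
    exact h1

theorem card_subtype_sigma_eq_sum {s : ℕ} {H : Fin s → Type*} [∀ k, Finite (H k)] (d : Fin s → ℕ)
    (n : ℕ) :
    Nat.card {t : Σ k, H k // d t.1 = n} = ∑ k, if d k = n then Nat.card (H k) else 0 := by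
  have e : {t : Σ k, H k // d t.1 = n} ≃ Σ k, {_h : H k // d k = n} :=
    { toFun := fun t => ⟨t.1.1, t.1.2, t.2⟩
      invFun := fun t => ⟨⟨t.1, t.2.1⟩, t.2.2⟩
      left_inv := fun _ => rfl
      right_inv := fun _ => rfl }
  rw [Nat.card_congr e, Nat.card_sigma]
  refine Finset.sum_congr rfl fun k _ => ?_
  split_ifs with h <;> simp [h]

end FiniteLevels

/-- The number of embeddings between finite fields. -/
theorem card_ringHom_galoisField {K : Type*} [Field K] [Finite K] {p₀ a : ℕ}
    (hp₀ : p₀.Prime) (hK : Nat.card K = p₀ ^ a) {p : ℕ} [Fact p.Prime]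
    {j : ℕ} (hj : j ≠ 0) :
    Nat.card (K →+* GaloisField p j) = if p₀ = p ∧ a ∣ j then a else 0 := by
  have := Fintype.ofFinite K
  have : Fact p₀.Prime := ⟨hp₀⟩
  have hchar : CharP K p₀ :=
    charP_of_card_eq_prime_pow (f := a) (by rw [← hK, Nat.card_eq_fintype_card])
  by_cases hp : p₀ = p
  · subst hp
    let _ : Algebra (ZMod p₀) K := ZMod.algebra K p₀
    have e : (K →+* GaloisField p₀ j) ≃ (K →ₐ[ZMod p₀] GaloisField p₀ j) :=
      { toFun := fun σ => { σ with
          commutes' := fun x => RingHom.congr_fun (Subsingleton.elim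
            (σ.comp (algebraMap (ZMod p₀) K)) (algebraMap (ZMod p₀) (GaloisField p₀ j))) x }
        invFun := fun σ => σ
        left_inv := fun _ => rfl
        right_inv := fun _ => rfl }
    have hrank : Module.finrank (ZMod p₀) K = a := by
      have := FiniteField.pow_finrank_eq_natCard p₀ K
      exact Nat.pow_right_injective hp₀.two_le (this.trans hK)
    have hrank' := GaloisField.finrank p₀ hj
    rw [Nat.card_congr e]
    split_ifs with h
    · rw [FiniteField.natCard_algHom_of_finrank_dvd (by rw [hrank, hrank']; exact h.2), hrank]
    · have : IsEmpty (K →ₐ[ZMod p₀] GaloisField p₀ j) := by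
        rw [← not_nonempty_iff, FiniteField.nonempty_algHom_iff_finrank_dvd, hrank, hrank']
        exact fun hc => h ⟨rfl, hc⟩
      simp
  · rw [if_neg fun h => hp h.1]
    have : IsEmpty (K →+* GaloisField p j) := ⟨fun σ => hp (by
      have h1 : CharP (GaloisField p j) p₀ := charP_of_injective_ringHom σ.injective p₀
      have h2 : CharP (GaloisField p j) p := charP_of_injective_algebraMap' (ZMod p) p
      exact CharP.eq (GaloisField p j) h1 h2)⟩
    simp

/-! ### The logarithm of the generation probability as a series. -/

section LogSeries

theorem pow_div_pow_mul_lt_one {q : ℝ} (hq : 1 < q) {ℓ d t : ℕ} (hℓ : 1 ≤ ℓ) (ht : t < d) :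
    q ^ t / q ^ (ℓ * d) < 1 := by
  rw [div_lt_one (by positivity)]
  exact pow_lt_pow_right₀ hq (ht.trans_le (Nat.le_mul_of_pos_left d hℓ))

/-- This sums $-\log(1-x)=\sum_m x^m/m$ over $x=q^{t-\ell d}$; for a prime power $q$ the inner sum
over $t$ is $|\mathbb{P}^{d-1}(\mathbb{F}_{q^m})|$. -/
theorem hasSum_neg_log_prod {q : ℝ} (hq : 1 < q) {ℓ : ℕ} (d : ℕ) (hℓ : 1 ≤ ℓ) :
    HasSum (fun m : ℕ+ => (1 / (m : ℝ)) * (q ^ (ℓ * d * m))⁻¹ *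
      ∑ t ∈ Finset.range d, (q ^ (m : ℕ)) ^ t)
      (-Real.log (∏ t ∈ Finset.range d, (1 - q ^ t / q ^ (ℓ * d)))) := by
  have h1 : ∀ t ∈ Finset.range d, HasSum (fun m : ℕ+ => (q ^ t / q ^ (ℓ * d)) ^ (m : ℕ) / (m : ℝ))
      (-Real.log (1 - q ^ t / q ^ (ℓ * d))) := by
    intro t ht
    have h0 : |q ^ t / q ^ (ℓ * d)| < 1 := by
      rw [abs_of_nonneg (by positivity)]
      exact pow_div_pow_mul_lt_one hq hℓ (Finset.mem_range.1 ht)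
    have := Real.hasSum_pow_div_log_of_abs_lt_one h0
    rw [← Equiv.pnatEquivNat.hasSum_iff] at this
    convert! this using 2 with m
    obtain ⟨m, rfl⟩ := Equiv.pnatEquivNat.symm.surjective m
    simp
  have h2 := hasSum_sum h1
  rw [Finset.sum_neg_distrib, ← Real.log_prod fun t ht =>
    (sub_pos.2 (pow_div_pow_mul_lt_one hq hℓ (Finset.mem_range.1 ht))).ne'] at h2
  convert! h2 using 2 with m
  rw [Finset.mul_sum]
  refine Finset.sum_congr rfl fun t _ => ?_
  rw [div_pow, ← pow_mul, ← pow_mul, ← pow_mul, mul_comm t]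
  field_simp

instance (p : Nat.Primes) : Fact (p : ℕ).Prime := ⟨p.2⟩

/-- The coefficient of `r*(G, 𝔽_{p^j}, n)` in the series for `log ζ_G(ℓ)`. -/
def zetaWeight (ℓ : ℕ) (t : Nat.Primes × ℕ+ × ℕ+) : ℝ :=
  (1 / ((t.2.2 : ℕ) : ℝ)) * (((t.1 : ℕ) : ℝ) ^ (ℓ * t.2.1 * t.2.2))⁻¹ *
    ∑ r ∈ Finset.range t.2.1, (((t.1 : ℕ) : ℝ) ^ (t.2.2 : ℕ)) ^ r

theorem zetaWeight_nonneg (ℓ : ℕ) (t : Nat.Primes × ℕ+ × ℕ+) : 0 ≤ zetaWeight ℓ t := by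
  unfold zetaWeight
  positivity

theorem card_projectivization_galoisField (p : ℕ) [Fact p.Prime] {j : ℕ} (hj : j ≠ 0) (n : ℕ) :
    Nat.card (ℙ (GaloisField p j) (Fin n → GaloisField p j)) =
      ∑ r ∈ Finset.range n, (p ^ j) ^ r := by
  rw [Projectivization.card_of_finrank _ _ (n := n) (by simp), GaloisField.card p j hj]

theorem zetaTerm_eq (G : Type u) [Group G] [TopologicalSpace G] (ℓ : ℕ)
    (t : Nat.Primes × ℕ+ × ℕ+) :
    zetaTerm G ℓ t =
      (((rStar G (GaloisField t.1 t.2.2) t.2.1).toNat * zetaWeight ℓ t : ℝ) : ℂ) := by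
  obtain ⟨p, n, j⟩ := t
  simp only [zetaTerm, zetaWeight]
  rw [card_projectivization_galoisField (p : ℕ) j.ne_zero]
  have : (-((ℓ : ℂ) * (n : ℕ) * (j : ℕ))) = -((ℓ * n * j : ℕ) : ℂ) := by push_cast; ring
  rw [this, Complex.cpow_neg, Complex.cpow_natCast]
  push_cast
  ring

theorem hasSum_zetaWeight_of_finite_field {K : Type*} [Field K] [Finite K] {ℓ d : ℕ}
    (hd : d ≠ 0) (hℓ : 1 ≤ ℓ) :
    HasSum (fun t : Nat.Primes × ℕ+ × ℕ+ =>
      (((if d = t.2.1 then Nat.card (K →+* GaloisField t.1 t.2.2) else 0) : ℕ) : ℝ) *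
        zetaWeight ℓ t)
      (-Real.log (∏ r ∈ Finset.range d,
        (1 - (Nat.card K : ℝ) ^ r / (Nat.card K : ℝ) ^ (ℓ * d)))) := by
  have := Fintype.ofFinite K
  obtain ⟨p, -, a, hp, hK⟩ := FiniteField.card' K
  rw [← Nat.card_eq_fintype_card] at hK
  have hq : (1 : ℝ) < Nat.card K := by exact_mod_cast Finite.one_lt_card
  let g : ℕ+ → Nat.Primes × ℕ+ × ℕ+ := fun m => (⟨p, hp⟩, ⟨d, Nat.pos_of_ne_zero hd⟩, a * m)
  have hg : Function.Injective g := fun m m' h =>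
    mul_left_cancel (congrArg (fun t => t.2.2) h)
  have hcard : ∀ t : Nat.Primes × ℕ+ × ℕ+, Nat.card (K →+* GaloisField t.1 t.2.2) =
      if p = t.1 ∧ (a : ℕ) ∣ t.2.2 then (a : ℕ) else 0 := fun t =>
    card_ringHom_galoisField hp hK t.2.2.ne_zero
  rw [← hg.hasSum_iff]
  · convert! hasSum_neg_log_prod hq d hℓ using 2 with m
    have ha : ((a : ℕ) : ℝ) ≠ 0 := by exact_mod_cast a.ne_zero
    have hc := hcard (g m)
    rw [if_pos ⟨rfl, Dvd.intro (m : ℕ) (PNat.mul_coe a m).symm⟩] at hc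
    rw [Function.comp_apply, hc, if_pos (show d = ((g m).2.1 : ℕ) from rfl), hK]
    simp only [g, zetaWeight, PNat.mk_coe, PNat.mul_coe]
    push_cast
    rw [← pow_mul, ← pow_mul, show ℓ * d * ((a : ℕ) * m) = a * (ℓ * d * m) by ring]
    field_simp
  · rintro ⟨p', n, j⟩ ht
    rw [hcard]
    split_ifs with h1 h2
    · exfalso
      obtain ⟨rfl, c, hc⟩ := h2
      have hc0 : 0 < c := Nat.pos_of_ne_zero fun h => j.ne_zero (by rw [hc, h, mul_zero])
      refine ht ⟨⟨c, hc0⟩, ?_⟩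
      refine Prod.ext rfl (Prod.ext (PNat.eq h1) (PNat.eq hc.symm))
    all_goals simp

end LogSeries

/-! ### Convergence from UBERG. -/

section Convergence

theorem zetaWeight_le (ℓ : ℕ) (t : Nat.Primes × ℕ+ × ℕ+) :
    zetaWeight ℓ t ≤ (((t.1 : ℕ) : ℝ) ^ (ℓ * t.2.1 * t.2.2))⁻¹ *
      ((t.1 : ℕ) : ℝ) ^ (t.2.1 * t.2.2 : ℕ) := by
  obtain ⟨p, n, j⟩ := t
  unfold zetaWeight
  have hj : (1 : ℝ) ≤ ((j : ℕ) : ℝ) := by exact_mod_cast j.pos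
  have h1 : 1 / ((j : ℕ) : ℝ) ≤ 1 := (div_le_one (by positivity)).2 hj
  have h2 : ∑ r ∈ Finset.range n, (((p : ℕ) : ℝ) ^ (j : ℕ)) ^ r ≤
      ((p : ℕ) : ℝ) ^ (n * j : ℕ) := by
    have h3 : 2 ≤ (p : ℕ) ^ (j : ℕ) := p.2.two_le.trans (Nat.le_self_pow j.ne_zero _)
    have h4 := (Nat.geomSum_lt h3 (s := Finset.range n) fun k hk => Finset.mem_range.1 hk).le
    rw [← pow_mul, mul_comm (j : ℕ)] at h4
    exact_mod_cast h4
  calc _ ≤ 1 * (((p : ℕ) : ℝ) ^ (ℓ * n * j : ℕ))⁻¹ * ((p : ℕ) : ℝ) ^ (n * j : ℕ) := by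
        gcongr
    _ = _ := by rw [one_mul]

/-- The exponent 4 suffices because $2+n+j\le 4nj$, so the terms are at most $p^{-2}2^{-n}2^{-j}$.
-/
theorem summable_prime_pow :
    Summable fun t : Nat.Primes × ℕ+ × ℕ+ =>
      (((t.1 : ℕ) : ℝ) ^ (4 * (t.2.1 * t.2.2 : ℕ)))⁻¹ := by
  have h1 : Summable fun p : Nat.Primes => ((((p : ℕ) : ℝ)) ^ 2)⁻¹ :=
    (Real.summable_nat_pow_inv.2 one_lt_two).subtype _
  have h2 : Summable fun n : ℕ+ => ((2 : ℝ) ^ (n : ℕ))⁻¹ := by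
    have := summable_geometric_two.comp_injective PNat.coe_injective
    simpa [Function.comp_def] using this
  refine ((h1.mul_of_nonneg (h2.mul_of_nonneg h2 (fun _ => by positivity) fun _ => by positivity)
    (fun _ => by positivity) fun _ => by positivity)).of_nonneg_of_le
      (fun _ => by positivity) fun t => ?_
  obtain ⟨p, n, j⟩ := t
  simp only
  rw [← mul_inv, ← mul_inv]
  have hp : (2 : ℝ) ≤ (p : ℕ) := by exact_mod_cast p.2.two_le
  refine inv_anti₀ (by positivity) ?_
  have hn := n.pos
  have hj := j.pos
  calc ((p : ℕ) : ℝ) ^ 2 * (2 ^ (n : ℕ) * 2 ^ (j : ℕ))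
      ≤ ((p : ℕ) : ℝ) ^ 2 * (((p : ℕ) : ℝ) ^ (n : ℕ) * ((p : ℕ) : ℝ) ^ (j : ℕ)) := by gcongr
    _ = ((p : ℕ) : ℝ) ^ (2 + (n + j : ℕ)) := by ring
    _ ≤ ((p : ℕ) : ℝ) ^ (4 * (n * j : ℕ)) := by
      refine pow_le_pow_right₀ (by linarith) ?_
      nlinarith [mul_pos hn hj, Nat.le_mul_of_pos_left (j : ℕ) hn,
        Nat.le_mul_of_pos_right (n : ℕ) hj]

/-- The UBERG bound makes the series for `log ζ_G(ℓ)` converge for large `ℓ`. -/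
theorem UBERG.summable {G : Type u} [Group G] [TopologicalSpace G] (hG : UBERG G) :
    ∃ L : ℕ, ∀ ℓ : ℕ, L ≤ ℓ → Summable fun t : Nat.Primes × ℕ+ × ℕ+ =>
      ((rStar G (GaloisField t.1 t.2.2) t.2.1).toNat : ℝ) * zetaWeight ℓ t := by
  obtain ⟨c, -, hc⟩ := hG
  obtain ⟨C, hC⟩ := exists_nat_ge c
  -- In units of $nj$ in the exponent of $p$: $C$ pays for $r^\ast$, 1 for the projective space, and
  -- 4 is left for `summable_prime_pow`.
  refine ⟨C + 5, fun ℓ hℓ => summable_prime_pow.of_nonneg_of_le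
    (fun t => mul_nonneg (by positivity) (zetaWeight_nonneg ℓ t)) fun t => ?_⟩
  have hp : 1 ≤ (t.1 : ℕ) := t.1.2.one_le
  have hp' : (1 : ℝ) ≤ (t.1 : ℕ) := by exact_mod_cast hp
  have hr : ((rStar G (GaloisField t.1 t.2.2) t.2.1).toNat : ℝ) ≤
      ((t.1 : ℕ) : ℝ) ^ (C * (t.2.1 * t.2.2 : ℕ)) := by
    have h1 := hc (GaloisField t.1 t.2.2) t.2.1
    rw [GaloisField.card _ _ t.2.2.ne_zero] at h1
    have h2 : (((t.1 : ℕ) ^ (t.2.2 : ℕ) : ℕ) : ℝ≥0∞) ^ (c * (t.2.1 : ℕ)) ≤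
        (((t.1 : ℕ) ^ (C * (t.2.1 * t.2.2 : ℕ)) : ℕ) : ℝ≥0∞) := by
      calc _ ≤ (((t.1 : ℕ) ^ (t.2.2 : ℕ) : ℕ) : ℝ≥0∞) ^ ((C * t.2.1 : ℕ) : ℝ) := by
            refine ENNReal.rpow_le_rpow_of_exponent_le ?_ ?_
            · exact_mod_cast Nat.one_le_pow _ _ hp
            · push_cast
              gcongr
        _ = _ := by
            rw [ENNReal.rpow_natCast, ← Nat.cast_pow, ← pow_mul]
            congr 2
            ring
    have h3 : rStar G (GaloisField t.1 t.2.2) t.2.1 ≤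
        (((t.1 : ℕ) ^ (C * (t.2.1 * t.2.2 : ℕ)) : ℕ) : ℕ∞) := by
      exact_mod_cast h1.trans h2
    have h4 := ENat.toNat_le_of_le_natCast h3
    exact_mod_cast h4
  calc _ ≤ ((t.1 : ℕ) : ℝ) ^ (C * (t.2.1 * t.2.2 : ℕ)) *
      ((((t.1 : ℕ) : ℝ) ^ (ℓ * t.2.1 * t.2.2))⁻¹ * ((t.1 : ℕ) : ℝ) ^ (t.2.1 * t.2.2 : ℕ)) :=
        mul_le_mul hr (zetaWeight_le ℓ t) (zetaWeight_nonneg ℓ t) (by positivity)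
    _ ≤ _ := by
      have h5 : ((t.1 : ℕ) : ℝ) ^ (C * (t.2.1 * t.2.2 : ℕ)) *
          ((t.1 : ℕ) : ℝ) ^ (t.2.1 * t.2.2 : ℕ) *
          ((t.1 : ℕ) : ℝ) ^ (4 * (t.2.1 * t.2.2 : ℕ)) ≤
          ((t.1 : ℕ) : ℝ) ^ (ℓ * t.2.1 * t.2.2) := by
        rw [← pow_add, ← pow_add]
        refine pow_le_pow_right₀ hp' ?_
        calc _ = (C + 5) * (t.2.1 * t.2.2 : ℕ) := by ring
          _ ≤ ℓ * (t.2.1 * t.2.2 : ℕ) := Nat.mul_le_mul_right _ hℓ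
          _ = _ := by ring
      have hp0 : (0 : ℝ) < (t.1 : ℕ) := by linarith
      rw [inv_eq_one_div, inv_eq_one_div, le_div_iff₀ (by positivity)]
      calc _ = (((t.1 : ℕ) : ℝ) ^ (C * (t.2.1 * t.2.2 : ℕ)) *
            ((t.1 : ℕ) : ℝ) ^ (t.2.1 * t.2.2 : ℕ) *
            ((t.1 : ℕ) : ℝ) ^ (4 * (t.2.1 * t.2.2 : ℕ))) /
            ((t.1 : ℕ) : ℝ) ^ (ℓ * t.2.1 * t.2.2) := by ring
        _ ≤ 1 := (div_le_one (by positivity)).2 h5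

/-- Guards against `toNat` sending `⊤` to 0, and makes each set of isomorphism classes finite. -/
theorem UBERG.rStar_ne_top {G : Type u} [Group G] [TopologicalSpace G] (hG : UBERG G)
    (F : Type) [Field F] [Finite F] (n : ℕ) : rStar G F n ≠ ⊤ := by
  obtain ⟨c, hc0, hc⟩ := hG
  intro h
  have h1 := hc F n
  rw [h] at h1
  have h2 : (Nat.card F : ℝ≥0∞) ^ (c * n) < ⊤ :=
    ENNReal.rpow_lt_top_of_nonneg (by positivity) (ENNReal.natCast_ne_top _)
  exact absurd (h1.trans_lt h2) (by simp)

end Convergence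

/-! ### Haar measure on compact groups: finite quotients and directed limits. -/

section HaarMeasure

open MeasureTheory Filter Topology

/-- The fibres of $f$ are open translates of one another, so they share the total mass 1 equally. -/
theorem addHaarMeasure_top_real_preimage {X : Type*} [AddCommGroup X] [TopologicalSpace X]
    [IsTopologicalAddGroup X] [CompactSpace X] [MeasurableSpace X] [BorelSpace X]
    {Y : Type*} [AddCommGroup Y] [Finite Y] (f : X →+ Y) (hf : Function.Surjective f)
    (hlc : IsLocallyConstant f) (S : Set Y) :
    (Measure.addHaarMeasure (⊤ : TopologicalSpace.PositiveCompacts X)).real (f ⁻¹' S) =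
      (Nat.card S : ℝ) / Nat.card Y := by
  classical
  have := Fintype.ofFinite Y
  set μ := Measure.addHaarMeasure (⊤ : TopologicalSpace.PositiveCompacts X)
  have hμ : μ Set.univ = 1 :=
    Measure.addHaarMeasure_self (K₀ := (⊤ : TopologicalSpace.PositiveCompacts X))
  have : IsProbabilityMeasure μ := ⟨hμ⟩
  have hmeas : ∀ y, MeasurableSet (f ⁻¹' {y}) := fun y => (hlc.isOpen_fiber y).measurableSet
  have htrans : ∀ y, μ.real (f ⁻¹' {y}) = μ.real (f ⁻¹' {0}) := fun y => by
    obtain ⟨x, rfl⟩ := hf y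
    have : f ⁻¹' {0} = (fun z => x + z) ⁻¹' (f ⁻¹' {f x}) := by
      ext z; simp
    rw [this, Measure.real, Measure.real, measure_preimage_add]
  have hfin : ∀ T : Finset Y, μ.real (f ⁻¹' T) = T.card * μ.real (f ⁻¹' {0}) := fun T => by
    have : f ⁻¹' (T : Set Y) = ⋃ y ∈ T, f ⁻¹' {y} := by ext; simp
    rw [this, measureReal_biUnion_finset (fun y _ y' _ h => ?_) fun y _ => hmeas y]
    · simp [htrans]
    · exact (Set.disjoint_singleton.2 h).preimage f
  have h1 := hfin Finset.univ
  rw [Finset.coe_univ, Set.preimage_univ, probReal_univ, Finset.card_univ] at h1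
  have h2 := hfin S.toFinset
  rw [Set.coe_toFinset, Set.toFinset_card] at h2
  rw [h2, Nat.card_eq_fintype_card, Nat.card_eq_fintype_card, eq_div_iff (by simp), mul_assoc,
    mul_comm (μ.real _), ← h1, mul_one]

/-- The index set may be uncountable, so sequential continuity from above does not apply. Outer
regularity gives an open neighbourhood of the intersection of nearly the same measure, and by
compactness it contains some $S_i$. -/
theorem tendsto_measureReal_iInter_of_isClosed {X : Type*} [TopologicalSpace X] [CompactSpace X]
    [MeasurableSpace X] [BorelSpace X] (μ : Measure X) [IsFiniteMeasure μ] [μ.OuterRegular]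
    {ι : Type*} [Preorder ι] [IsDirectedOrder ι] [Nonempty ι] {S : ι → Set X} (hS : Antitone S)
    (hcl : ∀ i, IsClosed (S i)) :
    Tendsto (fun i => μ.real (S i)) atTop (𝓝 (μ.real (⋂ i, S i))) := by
  refine (ENNReal.tendsto_toReal (measure_ne_top μ _)).comp ?_
  refine tendsto_order.2 ⟨fun r hr => Eventually.of_forall fun i =>
    hr.trans_le (measure_mono (Set.iInter_subset _ i)), fun r hr => ?_⟩
  obtain ⟨U, hSU, hU, hUr⟩ := Set.exists_isOpen_lt_of_lt _ r hr
  obtain ⟨i, hi⟩ := exists_subset_nhds_of_isCompact' (directed_of_isDirected_le hS)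
    (fun i => (hcl i).isCompact) hcl fun x hx => hU.mem_nhds (hSU hx)
  filter_upwards [eventually_ge_atTop i] with j hj
  exact (measure_mono ((hS hj).trans hi)).trans_lt hUr

end HaarMeasure

/-! ### Passage from the finite levels to the completed group ring. -/

section Levels

open Filter Topology MeasureTheory

variable (G : Type u) [Group G] [TopologicalSpace G]

/-- The index set of the inverse system, ordered by refinement. -/
structure RefinementLevel where
  /-- The underlying pair of an open normal subgroup and a modulus. -/
  index : CGRIndex G

/-- Larger means finer: smaller subgroup and more divisible modulus. The wrapper keeps this apart
from the product order on `CGRIndex`. -/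
instance : Preorder (RefinementLevel G) where
  le i i' := i'.index.1.toSubgroup ≤ i.index.1.toSubgroup ∧
    (i.index.2 : ℕ) ∣ (i'.index.2 : ℕ)
  le_refl i := ⟨le_rfl, dvd_rfl⟩
  le_trans i j k h h' := ⟨h'.1.trans h.1, h.2.trans h'.2⟩

instance : IsDirectedOrder (RefinementLevel G) where
  directed i i' := by
    refine ⟨⟨i.index.1 ⊓ i'.index.1, i.index.2 * i'.index.2⟩, ⟨?_, ?_⟩, ?_, ?_⟩
    · exact fun x hx => hx.1
    · exact Dvd.intro _ (PNat.mul_coe _ _).symm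
    · exact fun x hx => hx.2
    · exact Dvd.intro_left _ (PNat.mul_coe _ _).symm

instance : Nonempty (RefinementLevel G) :=
  ⟨⟨⟨⟨⊤, isOpen_univ⟩, inferInstanceAs (⊤ : Subgroup G).Normal⟩, 1⟩⟩

variable {G}

/-- The projection of the completed group ring onto a finite level. -/
def levelProj (i : CGRIndex G) : CompletedGroupRing G →+* finiteLevel i :=
  (Pi.evalRingHom _ i).comp (completedGroupSubring G).subtype

theorem levelMap_levelOf (i i' : CGRIndex G) (hN : i.1.toSubgroup ≤ i'.1.toSubgroup)
    (hm : (i'.2 : ℕ) ∣ (i.2 : ℕ)) (g : G) :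
    levelMap i i' hN hm (levelOf i g) = levelOf i' g := by
  simp only [levelMap, levelOf, RingHom.comp_apply, MonoidHom.comp_apply, MonoidAlgebra.of_apply,
    QuotientGroup.mk'_apply, MonoidAlgebra.mapDomainRingHom_apply, MonoidAlgebra.mapDomain_single,
    MonoidAlgebra.mapRingHom_single, map_one]
  rfl

theorem levelMap_levelProj (i i' : CGRIndex G) (hN : i.1.toSubgroup ≤ i'.1.toSubgroup)
    (hm : (i'.2 : ℕ) ∣ (i.2 : ℕ)) (x : CompletedGroupRing G) :
    levelMap i i' hN hm (levelProj i x) = levelProj i' x :=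
  x.2 i i' hN hm

theorem levelProj_surjective (i : CGRIndex G) : Function.Surjective (levelProj i) := by
  intro y
  induction y using finiteLevel_induction with
  | hof g => exact ⟨⟨fun i => levelOf i g, fun i i' hN hm => levelMap_levelOf i i' hN hm g⟩, rfl⟩
  | hzero => exact ⟨0, map_zero _⟩
  | hadd x y hx hy =>
    obtain ⟨x, rfl⟩ := hx
    obtain ⟨y, rfl⟩ := hy
    exact ⟨x + y, map_add _ _ _⟩

attribute [local instance] finiteLevelTopology finiteLevelDiscrete

theorem continuous_levelProj (i : CGRIndex G) : Continuous (levelProj i) :=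
  (continuous_apply i).comp continuous_subtype_val

theorem continuous_levelProj_comp (i : CGRIndex G) (ℓ : ℕ) :
    Continuous fun (x : Fin ℓ → CompletedGroupRing G) j => levelProj i (x j) :=
  continuous_pi fun j => (continuous_levelProj i).comp (continuous_apply j)

theorem exists_sum_eq_one_of_le {i i' : RefinementLevel G} (h : i ≤ i') {ℓ : ℕ}
    {c x : Fin ℓ → CompletedGroupRing G} (hc : levelProj i'.index (∑ j, c j * x j) = 1) :
    levelProj i.index (∑ j, c j * x j) = 1 := by
  rw [← levelMap_levelProj i'.index i.index h.1 h.2, hc, map_one]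

/-- A tuple generates the completed group ring if it does so at every finite level. -/
theorem exists_sum_eq_one_iff_forall_level [IsTopologicalGroup G] [CompactSpace G] {ℓ : ℕ}
    (x : Fin ℓ → CompletedGroupRing G) :
    (∃ c : Fin ℓ → CompletedGroupRing G, ∑ j, c j * x j = 1) ↔
      ∀ i : RefinementLevel G, ∃ c : Fin ℓ → finiteLevel i.index,
        ∑ j, c j * levelProj i.index (x j) = 1 := by
  constructor
  · rintro ⟨c, hc⟩ i
    exact ⟨fun j => levelProj i.index (c j), by simpa using congrArg (levelProj i.index) hc⟩
  · intro h
    -- The coefficient tuples that work at level $i$ form a decreasing directed family of nonempty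
    -- closed sets in a compact space; a common point works at all levels at once.
    let T : RefinementLevel G → Set (Fin ℓ → CompletedGroupRing G) := fun i =>
      {c | levelProj i.index (∑ j, c j * x j) = 1}
    have hcl : ∀ i, IsClosed (T i) := fun i =>
      isClosed_eq ((continuous_levelProj i.index).comp (continuous_finsetSum _ fun j _ =>
        (continuous_apply j).mul continuous_const)) continuous_const
    have hne : ∀ i, (T i).Nonempty := fun i => by
      obtain ⟨c, hc⟩ := h i
      choose c' hc' using fun j => levelProj_surjective i.index (c j)
      exact ⟨c', by simpa [T, hc'] using hc⟩
    have hanti : Antitone T := fun i i' hii' c hc => exists_sum_eq_one_of_le hii' hc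
    obtain ⟨c, hc⟩ := IsCompact.nonempty_iInter_of_directed_nonempty_isCompact_isClosed T
      (directed_of_isDirected_le hanti) hne (fun i => (hcl i).isCompact) hcl
    refine ⟨c, Subtype.ext (funext fun i => ?_)⟩
    exact Set.mem_iInter.1 hc ⟨i⟩

/-- The tuples over the completed group ring whose images generate a given finite level. -/
def generatesAtLevel (ℓ : ℕ) (i : RefinementLevel G) : Set (Fin ℓ → CompletedGroupRing G) :=
  {x | ∃ c : Fin ℓ → finiteLevel i.index, ∑ j, c j * levelProj i.index (x j) = 1}

theorem generatesAtLevel_antitone (ℓ : ℕ) : Antitone (generatesAtLevel (G := G) ℓ) := by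
  rintro i i' hii' x ⟨c, hc⟩
  choose c' hc' using fun j => levelProj_surjective i'.index (c j)
  have h1 := exists_sum_eq_one_of_le hii' (c := c') (x := x) (by simpa [hc'] using hc)
  exact ⟨fun j => levelProj i.index (c' j), by simpa using h1⟩

theorem isClosed_generatesAtLevel (ℓ : ℕ) (i : RefinementLevel G) :
    IsClosed (generatesAtLevel (G := G) ℓ i) :=
  (isClosed_discrete {y : Fin ℓ → finiteLevel i.index | ∃ c : Fin ℓ → finiteLevel i.index,
    ∑ j, c j * y j = 1}).preimage (continuous_levelProj_comp i.index ℓ)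

theorem iInter_generatesAtLevel [IsTopologicalGroup G] [CompactSpace G] (ℓ : ℕ) :
    ⋂ i, generatesAtLevel (G := G) ℓ i =
      {x | Submodule.span (CompletedGroupRing G) (Set.range x) = ⊤} := by
  ext x
  rw [Set.mem_iInter, Set.mem_ofPred_eq, span_range_eq_top_iff_exists_sum,
    exists_sum_eq_one_iff_forall_level]
  rfl

/-- The logarithm of the probability of generating a finite level, as a series over its absolutely
irreducible representations. -/
theorem measureReal_generatesAtLevel [IsTopologicalGroup G] [CompactSpace G] {ℓ : ℕ} (hℓ : 1 ≤ ℓ)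
    [MeasurableSpace (Fin ℓ → CompletedGroupRing G)] [BorelSpace (Fin ℓ → CompletedGroupRing G)]
    (i : RefinementLevel G) :
    (Measure.addHaarMeasure (⊤ : TopologicalSpace.PositiveCompacts
      (Fin ℓ → CompletedGroupRing G))).real (generatesAtLevel ℓ i) =
    Real.exp (-∑' t : Nat.Primes × ℕ+ × ℕ+,
      (Nat.card (levelClasses (GaloisField t.1 t.2.2) (t.2.1 : ℕ) i.index) : ℝ) *
        zetaWeight ℓ t) := by
  have := finite_finiteLevel G i.index
  obtain ⟨s, K, d, _, π, hK, hd, hπ, hker⟩ := exists_surjective_pi_matrix (finiteLevel i.index)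
  let B := ∀ k, Matrix (Fin (d k)) (Fin (d k)) (K k)
  let f : (Fin ℓ → CompletedGroupRing G) →+ (Fin ℓ → B) :=
    ((π.comp (levelProj i.index)) : CompletedGroupRing G →+ B).compLeft (Fin ℓ)
  have hf : Function.Surjective f := (hπ.comp (levelProj_surjective i.index)).comp_left
  have hlc : IsLocallyConstant f :=
    (IsLocallyConstant.of_discrete fun (y : Fin ℓ → finiteLevel i.index) j =>
      π (y j)).comp_continuous (continuous_levelProj_comp i.index ℓ)
  have hpre : generatesAtLevel ℓ i = f ⁻¹' {y | ∃ c : Fin ℓ → B, ∑ j, c j * y j = 1} := by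
    ext x
    exact exists_sum_eq_one_iff_of_surjective π hπ (fun a => (hker a).1) _
  have hprod : (Nat.card {y : Fin ℓ → B | ∃ c : Fin ℓ → B, ∑ j, c j * y j = 1} : ℝ) /
      Nat.card (Fin ℓ → B) = ∏ k, ∏ r ∈ Finset.range (d k),
        (1 - (Nat.card (K k) : ℝ) ^ r / (Nat.card (K k) : ℝ) ^ (ℓ * d k)) :=
    card_generating_pi_tuples.trans
      (Finset.prod_congr rfl fun k _ => card_generating_matrix_tuples hℓ)
  rw [hpre, addHaarMeasure_top_real_preimage f hf hlc, hprod]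
  have hpos : ∀ k, 0 < ∏ r ∈ Finset.range (d k),
      (1 - (Nat.card (K k) : ℝ) ^ r / (Nat.card (K k) : ℝ) ^ (ℓ * d k)) := fun k =>
    Finset.prod_pos fun r hr => sub_pos.2 (pow_div_pow_mul_lt_one
      (by exact_mod_cast Finite.one_lt_card) hℓ (Finset.mem_range.1 hr))
  have hsum := hasSum_sum fun k (_ : k ∈ Finset.univ) =>
    hasSum_zetaWeight_of_finite_field (K := K k) (NeZero.ne (d k)) hℓ
  rw [Finset.sum_neg_distrib, ← Real.log_prod fun k _ => (hpos k).ne'] at hsum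
  have hterm : ∀ t : Nat.Primes × ℕ+ × ℕ+,
      (Nat.card (levelClasses (GaloisField t.1 t.2.2) (t.2.1 : ℕ) i.index) : ℝ) *
        zetaWeight ℓ t = ∑ k, (((if d k = t.2.1 then Nat.card (K k →+* GaloisField t.1 t.2.2)
          else 0) : ℕ) : ℝ) * zetaWeight ℓ t := fun t => by
    have : ∀ k, Finite (K k →+* GaloisField t.1 t.2.2) := fun k =>
      Finite.of_injective _ DFunLike.coe_injective
    rw [card_levelClasses _ _ _ hπ hker, card_subtype_sigma_eq_sum, Nat.cast_sum, Finset.sum_mul]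
  rw [tsum_congr hterm, hsum.tsum_eq, neg_neg, Real.exp_log (Finset.prod_pos fun k _ => hpos k)]

theorem finite_of_rStar_ne_top {F : Type} [Field F] {n : ℕ} (h : rStar G F n ≠ ⊤) :
    Finite (Quotient (absIrrRepSetoid G F n)) := by
  rwa [rStar, ← lt_top_iff_ne_top, ENat.card_lt_top] at h

theorem rStar_toNat {F : Type} [Field F] {n : ℕ} :
    (rStar G F n).toNat = Nat.card (Quotient (absIrrRepSetoid G F n)) := rfl

/-- Every continuous absolutely irreducible representation factors through a finite level. -/
theorem exists_mem_levelClasses [IsTopologicalGroup G] {F : Type} [Field F] [Finite F] {n : ℕ}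
    (q : Quotient (absIrrRepSetoid G F n)) :
    ∃ i : RefinementLevel G, ∀ i', i ≤ i' → q ∈ levelClasses F n i'.index := by
  obtain ⟨ρ, rfl⟩ := Quotient.exists_rep q
  let N : OpenNormalSubgroup G :=
    ⟨⟨(ρ.1 : G →* _).ker, ρ.2.1.isOpen_fiber 1⟩,
      inferInstanceAs ((ρ.1 : G →* Module.End F (Fin n → F)).ker).Normal⟩
  -- The kernel is open by local constancy, and the modulus $|F|$ vanishes in $F$; both conditions
  -- persist under refinement.
  refine ⟨⟨N, ⟨Nat.card F, Nat.card_pos⟩⟩, fun i' hi' => ⟨?_, ρ, rfl, hi'.1⟩⟩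
  obtain ⟨m, hm⟩ := hi'.2
  have := Fintype.ofFinite F
  rw [hm, PNat.mk_coe, Nat.cast_mul, Nat.card_eq_fintype_card, Nat.cast_card_eq_zero, zero_mul]

theorem eventually_levelClasses_eq_univ [IsTopologicalGroup G] {F : Type} [Field F] [Finite F]
    {n : ℕ} (h : rStar G F n ≠ ⊤) :
    ∀ᶠ i : RefinementLevel G in atTop, levelClasses F n i.index = Set.univ := by
  have := finite_of_rStar_ne_top h
  simp only [Set.eq_univ_iff_forall]
  rw [eventually_all]
  intro q
  obtain ⟨i, hi⟩ := exists_mem_levelClasses q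
  filter_upwards [eventually_ge_atTop i] with i' hi' using hi i' hi'

/-- Dominated convergence: each term involves finitely many classes, so it is eventually equal to
its limit, and the full series is the dominating one. -/
theorem tendsto_tsum_levelClasses [IsTopologicalGroup G] (hG : UBERG G) {ℓ : ℕ}
    (hs : Summable fun t : Nat.Primes × ℕ+ × ℕ+ =>
      ((rStar G (GaloisField t.1 t.2.2) t.2.1).toNat : ℝ) * zetaWeight ℓ t) :
    Tendsto (fun i : RefinementLevel G => ∑' t : Nat.Primes × ℕ+ × ℕ+,
      (Nat.card (levelClasses (GaloisField t.1 t.2.2) (t.2.1 : ℕ) i.index) : ℝ) *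
        zetaWeight ℓ t) atTop
      (𝓝 (∑' t : Nat.Primes × ℕ+ × ℕ+,
        ((rStar G (GaloisField t.1 t.2.2) t.2.1).toNat : ℝ) * zetaWeight ℓ t)) := by
  refine tendsto_tsum_of_dominated_convergence hs (fun t => ?_) (Eventually.of_forall fun i t => ?_)
  · refine tendsto_const_nhds.congr' ?_
    filter_upwards [eventually_levelClasses_eq_univ
      (hG.rStar_ne_top (GaloisField t.1 t.2.2) t.2.1)] with i hi
    rw [hi, rStar_toNat, Nat.card_univ]
  · have := finite_of_rStar_ne_top (hG.rStar_ne_top (GaloisField t.1 t.2.2) t.2.1)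
    rw [Real.norm_of_nonneg (mul_nonneg (by positivity) (zetaWeight_nonneg ℓ t)), rStar_toNat]
    refine mul_le_mul_of_nonneg_right ?_ (zetaWeight_nonneg ℓ t)
    exact_mod_cast Nat.card_le_card_of_injective _ Subtype.val_injective

instance : T2Space (CompletedGroupRing G) :=
  inferInstanceAs (T2Space (completedGroupSubring G))

theorem generationProb_eq_exp [IsTopologicalGroup G] [CompactSpace G] (hG : UBERG G) {ℓ : ℕ}
    (hℓ : 1 ≤ ℓ) (hs : Summable fun t : Nat.Primes × ℕ+ × ℕ+ =>
      ((rStar G (GaloisField t.1 t.2.2) t.2.1).toNat : ℝ) * zetaWeight ℓ t) :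
    generationProb (CompletedGroupRing G) ℓ = Real.exp (-∑' t : Nat.Primes × ℕ+ × ℕ+,
      ((rStar G (GaloisField t.1 t.2.2) t.2.1).toNat : ℝ) * zetaWeight ℓ t) := by
  let _ : MeasurableSpace (Fin ℓ → CompletedGroupRing G) := borel _
  have : BorelSpace (Fin ℓ → CompletedGroupRing G) := ⟨rfl⟩
  have h1 := tendsto_measureReal_iInter_of_isClosed
    (Measure.addHaarMeasure (⊤ : TopologicalSpace.PositiveCompacts (Fin ℓ → CompletedGroupRing G)))
    (generatesAtLevel_antitone (G := G) ℓ) (isClosed_generatesAtLevel ℓ)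
  rw [iInter_generatesAtLevel] at h1
  have h2 := (Real.continuous_exp.tendsto _).comp (tendsto_tsum_levelClasses hG hs).neg
  refine tendsto_nhds_unique h1 (h2.congr fun i => ?_)
  exact (measureReal_generatesAtLevel hℓ i).symm

end Levels

end
theorem theoremA {G : Type u} [Group G] [TopologicalSpace G] [IsTopologicalGroup G]
    [CompactSpace G] [T2Space G] [TotallyDisconnectedSpace G] (hG : UBERG G) :
    ∃ L : ℕ, ∀ ℓ : ℕ, L ≤ ℓ →
      Summable (zetaTerm G (ℓ : ℂ)) ∧
      ((generationProb (CompletedGroupRing G) ℓ : ℝ) : ℂ)⁻¹ = zetaG G (ℓ : ℂ) := by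
  obtain ⟨L, hL⟩ := hG.summable
  -- The extra 1 guarantees $\ell\ge 1$, required by the probability formula at the finite levels.
  refine ⟨L + 1, fun ℓ hℓ => ?_⟩
  have hs := hL ℓ (by omega)
  have hterm : zetaTerm G (ℓ : ℂ) = fun t =>
      (((rStar G (GaloisField t.1 t.2.2) t.2.1).toNat * zetaWeight ℓ t : ℝ) : ℂ) :=
    funext fun t => zetaTerm_eq G ℓ t
  refine ⟨?_, ?_⟩
  · rw [hterm]
    exact Complex.summable_ofReal.2 hs
  · rw [zetaG, hterm, ← Complex.ofReal_tsum, generationProb_eq_exp hG (by omega) hs, Real.exp_neg,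
      Complex.ofReal_inv, inv_inv, Complex.ofReal_exp]
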